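/- Let $\gamma,\beta>0$, $0<\kappa<1/2$ and $k\in\{1,2,\dots\}$ be fixed, and let $\mathbb T$ be the torus of length $2\pi$ with the real Fourier basis $e_0(x)=1$, $e_n(x)=\pi^{-1/2}\cos(nx)$, $e_{-n}(x)=\pi^{-1/2}\sin(nx)$ ($n\ge1$). For $N\in\mathbb N$ identify $u(x)=\sum_{|n|\le N}\hat u(n)e_n(x)$ with $(\hat u(n))_{|n|\le N}\in\mathbb R^{2N+1}$, let $\mathrm du$ be Lebesgue measure in these coordinates, and write $u_\perp=u-\hat u(0)$. Let $$F(u)=\int_{\mathbb T}\Big(\frac{|\nabla u(x)|^2}{2}-\frac\gamma\beta\cos(\beta u(x))\Big)\,\mathrm dx+\max\big(0,|\hat u(0)|-2\pi k/\beta\big)^2 .$$ Consider the diffusion on $\mathbb R^{2N+1}$ given by the $L^2$-gradient flow of $F$ driven by projected space-time white noise, $$\partial_t u-\Delta u=-\gamma\,\Pi_N\sin(\beta u)-\frac1\pi\max\big(0,|\hat u(0)|-2\pi k/\beta\big)\operatorname{sign}(\hat u(0))+\sqrt{2\epsilon}\,\Pi_N\xi ,$$ where $\Pi_N$ is the projection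 to wavenumbers $|n|\le N$. For disjoint sets $B,A$ let $h_{B,A}(u)=\mathbb P_u(\tau_B<\tau_A)$, where $\tau$ denotes the first hitting time of a set by the diffusion started at $u$. Put $$A_\epsilon=\{u:\ |\hat u(0)|>2\pi/\beta-\sqrt\epsilon\log(1/\epsilon)\},$$ $$B_\epsilon=\{u:\ |\hat u(0)|<\sqrt\epsilon\log(1/\epsilon),\ \|u_\perp\|_{\mathcal C^{1/2-\kappa}}<\sqrt{c_0\,\epsilon\log(1/\epsilon)}\},$$ where $\mathcal C^{s}=B^{s}_{\infty,\infty}$ has the norm $\sup_{j\ge-1}2^{js}\|\Delta_j u\|_{L^\infty}$ given by a fixed smooth dyadic (Littlewood--Paley) partition of unity. Then for every sufficiently large $c_0$ (depending only on $\gamma,\beta,\kappa,k$ and the partition of unity) there exist $C>0$ and $\epsilon_0>0$, independent of $N$, such that for all $0<\epsilon<\epsilon_0$ and all $N\in\mathbb N$ $$M_{N,\epsilon}\,(1-C\epsilon)\ \le\ \int_{A_\epsilon^\complement}h_{B_\epsilon,A_\epsilon}(u)\,e^{-F(u)/\epsilon}\,\mathrm du\ \le\ M_{N,\epsilon}\,\big(1+C\epsilon\log(1/\epsilon)^4\big),$$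 where $$M_{N,\epsilon}=\sqrt{\frac{\epsilon}{\gamma\beta}\prod_{0<|n|\le N}\frac{2\pi\epsilon}{n^2+\gamma\beta}}\;e^{2\pi\gamma/(\epsilon\beta)} .$$ -/

import Mathlib

open MeasureTheory ProbabilityTheory
open scoped NNReal ENNReal

noncomputable section

namespace SineGordon

/-- Wavenumbers of magnitude at most `N`. -/
abbrev Mode (N : ℕ) : Type := ↥(Finset.Icc (-(N : ℤ)) (N : ℤ))

/-- Fourier-truncated functions on the torus, identified with their real Fourier coefficients
in `ℝ^(2N+1)`. The measure `volume` is Lebesgue measure in these coordinates. -/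
abbrev Coeff (N : ℕ) : Type := Mode N → ℝ

/-- The real Fourier basis on the torus of length `2π`: the constant `1` (not normalized),
`cos (n x) / √π` for `n > 0` and `sin (|n| x) / √π` for `n < 0`. -/
def basisFun (n : ℤ) (x : ℝ) : ℝ :=
  if n = 0 then 1
  else if 0 < n then Real.cos (n * x) / √Real.pi
  else Real.sin (-n * x) / √Real.pi

/-- `‖e_n‖²` in `L²` of the torus (it is `2π` for `n = 0` and `1` otherwise). -/
def basisNormSq (n : ℤ) : ℝ := ∫ x in (0 : ℝ)..2 * Real.pi, basisFun n x ^ 2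

variable {N : ℕ}

/-- The function `u(x) = ∑_{|n| ≤ N} û(n) e_n(x)`. -/
def toFun (u : Coeff N) (x : ℝ) : ℝ := ∑ n : Mode N, u n * basisFun n x

/-- The wavenumber `0`. -/
def zeroMode (N : ℕ) : Mode N := ⟨0, by simp⟩

/-- The mean `û(0)`. -/
def mean (u : Coeff N) : ℝ := u (zeroMode N)

/-- The oscillatory part of `u`. -/
def perp (u : Coeff N) : Coeff N := fun n => if (n : ℤ) = 0 then 0 else u n

/-- The potential energy
`F[u] = ∫ (|∇u|² / 2 - (γ / β) cos (β u)) dx + max (0, |û(0)| - 2πk/β)²`. -/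
def energy (γ β : ℝ) (k : ℕ) (u : Coeff N) : ℝ :=
  (∫ x in (0 : ℝ)..2 * Real.pi,
      (deriv (toFun u) x ^ 2 / 2 - γ / β * Real.cos (β * toFun u x)))
    + max 0 (|mean u| - 2 * Real.pi * k / β) ^ 2

/-- The `n`-th Fourier coefficient of a function on the torus, with respect to `basisFun`. -/
def coeffOf (f : ℝ → ℝ) (n : ℤ) : ℝ :=
  (∫ x in (0 : ℝ)..2 * Real.pi, f x * basisFun n x) / basisNormSq n

/-- The drift `Δu - γ Π_N sin (β u) - (L²-gradient of the confining term)` of the Galerkin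
system, in Fourier coordinates. The confining term is a function `G` of
`û(0) = (2π)⁻¹ ∫ u`, so its `L²`-gradient is the constant function `(2π)⁻¹ G'(û(0))`. -/
def drift (γ β : ℝ) (k : ℕ) (u : Coeff N) (n : Mode N) : ℝ :=
  -((n : ℤ) : ℝ) ^ 2 * u n
    - γ * coeffOf (fun x => Real.sin (β * toFun u x)) n
    - (if (n : ℤ) = 0 then
        (2 * Real.pi)⁻¹ *
          (2 * max 0 (|mean u| - 2 * Real.pi * k / β) * Real.sign (mean u))
      else 0)

/-- Independent standard real Brownian motions, one for each wavenumber: the coordinates of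
the truncated space-time white noise in the orthonormal basis `e_n / ‖e_n‖` (integrated in
time). -/
structure IsNoise {Ω : Type*} [MeasurableSpace Ω] (P : Measure Ω)
    (W : Mode N → ℝ≥0 → Ω → ℝ) : Prop where
  brownian : ∀ n, IsBrownianReal (W n) P
  indep : iIndepFun (fun (n : Mode N) (ω : Ω) (t : ℝ≥0) => W n t ω) P

/-- `X` is a solution, started at `z` and driven by `W`, of the Galerkin equation
`∂ₜu - Δu = -γ Π_N sin (β Π_N u) + √(2ε) Π_N ξ` (with the confining force), written as a
stochastic integral equation for the Fourier coefficients. The noise is additive, so the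
equation makes sense pathwise. -/
structure IsSolution {Ω : Type*} [MeasurableSpace Ω] (γ β ε : ℝ) (k : ℕ) (P : Measure Ω)
    (W : Mode N → ℝ≥0 → Ω → ℝ) (z : Coeff N) (X : ℝ≥0 → Ω → Coeff N) : Prop where
  continuous : ∀ᵐ ω ∂P, Continuous fun t => X t ω
  integral_eq : ∀ᵐ ω ∂P, ∀ (t : ℝ≥0) (n : Mode N),
    X t ω n = z n + (∫ s in (0 : ℝ)..t, drift γ β k (X s.toNNReal ω) n)
      + √(2 * ε) * (W n t ω / √(basisNormSq n))

/-- The equilibrium potential `h_{B,A}(z) = ℙ_z(τ_B < τ_A)`, for a family `X z` of processes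
started at the points `z`. -/
def equilibriumPotential {Ω : Type*} [MeasurableSpace Ω] (P : Measure Ω)
    (X : Coeff N → ℝ≥0 → Ω → Coeff N) (B A : Set (Coeff N)) (z : Coeff N) : ℝ≥0∞ :=
  P {ω | hittingAfter (X z) B 0 ω < hittingAfter (X z) A 0 ω}

/-- A cutoff function generating a smooth dyadic (Littlewood-Paley) partition of unity
`1 = θ(ξ) + ∑_{j ≥ 1} (θ(2⁻ʲ ξ) - θ(2⁻⁽ʲ⁻¹⁾ ξ))`. -/
structure IsDyadicCutoff (θ : ℝ → ℝ) : Prop where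
  smooth : ContDiff ℝ (⊤ : ℕ∞) θ
  even : ∀ ξ, θ (-ξ) = θ ξ
  mem_Icc : ∀ ξ, θ ξ ∈ Set.Icc (0 : ℝ) 1
  eq_one : ∃ a > 0, ∀ ξ, |ξ| ≤ a → θ ξ = 1
  eq_zero : ∃ b, ∀ ξ, b ≤ |ξ| → θ ξ = 0

/-- The Fourier multiplier of the `j`-th Littlewood-Paley block; `j = 0` is the low-frequency
block, which is often numbered `-1`. -/
def blockMultiplier (θ : ℝ → ℝ) (j : ℕ) (ξ : ℝ) : ℝ :=
  if j = 0 then θ ξ else θ (ξ / 2 ^ j) - θ (ξ / 2 ^ (j - 1))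

/-- The `j`-th Littlewood-Paley block of `u`, as a function on the torus. -/
def block (θ : ℝ → ℝ) (j : ℕ) (u : Coeff N) (x : ℝ) : ℝ :=
  ∑ n : Mode N, blockMultiplier θ j ((n : ℤ) : ℝ) * u n * basisFun n x

/-- The Besov-Hölder norm of `𝒞^s = B^s_{∞,∞}`, namely `sup_{j ≥ -1} 2^{js} ‖Δ_j u‖_∞`
(the index `j` is shifted by one here). -/
def besovHolderNorm (θ : ℝ → ℝ) (s : ℝ) (u : Coeff N) : ℝ≥0∞ :=
  ⨆ (j : ℕ) (x : ℝ), ENNReal.ofReal ((2 : ℝ) ^ (((j : ℝ) - 1) * s) * |block θ j u x|)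

/-- The target set: neighbourhoods `|û(0)| > 2π/β - √ε log(1/ε)` of the adjacent wells, as a
union of two strips. -/
def targetSet (N : ℕ) (β ε : ℝ) : Set (Coeff N) :=
  {u | mean u < -(2 * Real.pi / β) + √ε * Real.log (1 / ε)} ∪
    {u | 2 * Real.pi / β - √ε * Real.log (1 / ε) < mean u}

/-- The initial set `|û(0)| < √ε log(1/ε)`, `‖u_⊥‖_{𝒞^{1/2-κ}} < √(c₀ ε log(1/ε))`. -/
def initialSet (N : ℕ) (θ : ℝ → ℝ) (κ c₀ ε : ℝ) : Set (Coeff N) :=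
  {u | |mean u| < √ε * Real.log (1 / ε) ∧
    besovHolderNorm θ (1 / 2 - κ) (perp u)
      < ENNReal.ofReal (√(c₀ * ε * Real.log (1 / ε)))}

/-- The leading term
`√((ε/(γβ)) ∏_{0 < |n| ≤ N} 2πε/(n² + γβ)) e^{2πγ/(εβ)}`. -/
def wellMass (N : ℕ) (γ β ε : ℝ) : ℝ :=
  √(ε / (γ * β) * ∏ n ∈ (Finset.Icc (-(N : ℤ)) (N : ℤ)).erase 0,
      2 * Real.pi * ε / ((n : ℝ) ^ 2 + γ * β))
    * Real.exp (2 * Real.pi * γ / (ε * β))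

end SineGordon

end

/-! The dynamics enters only through two facts: the equilibrium potential is at most `1`, and it
equals `1` on the initial set (`equilibriumPotential_eq_one`). There a path already sits in `B`, and
continuity keeps it away from `A` for a positive time. The integral therefore lies between the
integrals of `exp (-F/ε)` over `B` and over the complement of `A`. What remains is a Laplace
asymptotic at the bottom of the well, uniform in `N`.

The leading term is exactly `exp (2πγ/(εβ))` times the mass of the Gaussian with precisions
`wellPrecision` (`wellMass_eq`). For the lower bound, `cos y ≥ 1 - y²/2` holds globally, so `exp
(-F/ε)` dominates that Gaussian without error, and the Gaussian gives `B` all but a fraction `O(ε)`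
of its mass. This needs a tail bound for the Besov-Hölder norm that does not depend on `N`
(`exists_besovHolderNorm_tail`).

For the upper bound the complement of `A` is covered by three sets, with `L = log (1/ε)`. On `B` the
sup norm is `O(√ε L)`, so the quartic remainder of the cosine costs a factor `1 + O(ε L⁴)`
(`lintegral_initialSet_le`). The others are fields with small mean but large oscillation
(`lintegral_rough_le`) and fields with mean between the wells (`lintegral_between_wells_le`). There
the pointwise inequality `coercivity_mul_sq_le` trades a quarter of `∫ u_⊥²` for coercivity in the
mean. The resulting precisions `n² - 1/2` stay positive for `n ≠ 0`, and since `∑ 1/n²` converges,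
the change of normalization is bounded in `N` (`exists_gaussMass_le`). Both sets contribute `O(ε)`
relative to the leading term. -/

noncomputable section
namespace SineGordon

variable {N : ℕ}

/-! ### The trigonometric basis -/

lemma basisFun_zero (x : ℝ) : basisFun 0 x = 1 := by simp [basisFun]

lemma abs_basisFun_le {n : ℤ} (hn : n ≠ 0) (x : ℝ) : |basisFun n x| ≤ 1 / √Real.pi := by
  unfold basisFun
  rw [if_neg hn]
  split_ifs <;> rw [abs_div, abs_of_nonneg (Real.sqrt_nonneg Real.pi)] <;> gcongr
  · exact Real.abs_cos_le_one _
  · exact Real.abs_sin_le_one _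

/-- With cosines at `n > 0` and sines at `n < 0`, a single formula covers all signs: differentiation
swaps `n` and `-n`. -/
lemma hasDerivAt_basisFun (n : ℤ) (x : ℝ) :
    HasDerivAt (basisFun n) (-(n : ℝ) * basisFun (-n) x) x := by
  rcases lt_trichotomy n 0 with h | h | h
  · have : basisFun n = fun x => Real.sin (-n * x) / √Real.pi := by
      ext y; simp [basisFun, h.ne, h.not_gt]
    rw [this]
    have h2 : basisFun (-n) x = Real.cos (-n * x) / √Real.pi := by
      simp [basisFun, h.ne, h]
    rw [h2]
    have := (((hasDerivAt_id x).const_mul (-(n : ℝ))).sin).div_const (√Real.pi)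
    exact this.congr_deriv (by simp; ring)
  · subst h
    have : basisFun 0 = fun _ => 1 := by ext y; simp [basisFun]
    rw [this]
    simpa using hasDerivAt_const x (1 : ℝ)
  · have : basisFun n = fun x => Real.cos (n * x) / √Real.pi := by
      ext y; simp [basisFun, h.ne', h]
    rw [this]
    have h2 : basisFun (-n) x = Real.sin (n * x) / √Real.pi := by
      simp [basisFun, h.ne', h.le]
    rw [h2]
    have := (((hasDerivAt_id x).const_mul (n : ℝ)).cos).div_const (√Real.pi)
    exact this.congr_deriv (by simp; ring)

@[fun_prop]
lemma continuous_basisFun (n : ℤ) : Continuous (basisFun n) :=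
  continuous_iff_continuousAt.2 fun x => (hasDerivAt_basisFun n x).continuousAt

lemma basisFun_periodic (n : ℤ) : Function.Periodic (basisFun n) (2 * Real.pi) := by
  intro x
  unfold basisFun
  have h1 : Real.cos (n * (x + 2 * Real.pi)) = Real.cos (n * x) := by
    rw [mul_add, Real.cos_add_int_mul_two_pi]
  have h2 : Real.sin (-n * (x + 2 * Real.pi)) = Real.sin (-n * x) := by
    have := Real.sin_add_int_mul_two_pi (-n * x) (-n)
    rw [mul_add]; push_cast at this; exact this
  rw [h1, h2]

lemma integral_cos_int_mul (k : ℤ) :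
    ∫ x in (0 : ℝ)..2 * Real.pi, Real.cos (k * x) = if k = 0 then 2 * Real.pi else 0 := by
  split_ifs with h
  · simp [h]
  · have hk : (k : ℝ) ≠ 0 := by exact_mod_cast h
    rw [intervalIntegral.integral_comp_mul_left (fun x => Real.cos x) hk]
    have := Real.sin_add_int_mul_two_pi 0 k
    simp only [zero_add, Real.sin_zero] at this
    simp [this]

lemma integral_sin_int_mul (k : ℤ) :
    ∫ x in (0 : ℝ)..2 * Real.pi, Real.sin (k * x) = 0 := by
  by_cases h : k = 0
  · simp [h]
  · have hk : (k : ℝ) ≠ 0 := by exact_mod_cast h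
    rw [intervalIntegral.integral_comp_mul_left (fun x => Real.sin x) hk]
    simp

lemma integral_basisFun {n : ℤ} (hn : n ≠ 0) :
    ∫ x in (0 : ℝ)..2 * Real.pi, basisFun n x = 0 := by
  unfold basisFun
  simp only [hn, if_false]
  split_ifs
  · rw [intervalIntegral.integral_div, integral_cos_int_mul]; simp [hn]
  · rw [intervalIntegral.integral_div]
    have := integral_sin_int_mul (-n)
    push_cast at this
    rw [this]; simp

lemma integral_basisFun_mul {p q : ℤ} (hp : p ≠ 0) (hq : q ≠ 0) :
    ∫ x in (0 : ℝ)..2 * Real.pi, basisFun p x * basisFun q x = if p = q then 1 else 0 := by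
  have hpi : √Real.pi * √Real.pi = Real.pi := Real.mul_self_sqrt Real.pi_pos.le
  have ic : ∀ k : ℤ, IntervalIntegrable (fun x => Real.cos (k * x)) volume 0 (2 * Real.pi) :=
    fun k => (by fun_prop : Continuous _).intervalIntegrable _ _
  have is : ∀ k : ℤ, IntervalIntegrable (fun x => Real.sin (k * x)) volume 0 (2 * Real.pi) :=
    fun k => (by fun_prop : Continuous _).intervalIntegrable _ _
  have hdiv : ∀ s t : ℝ, s / √Real.pi * (t / √Real.pi) = s * t / Real.pi := by
    intro s t; rw [div_mul_div_comm, hpi]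
  rcases lt_or_gt_of_ne hp with h1 | h1 <;> rcases lt_or_gt_of_ne hq with h2 | h2
  · have : ∀ x, basisFun p x * basisFun q x
        = (Real.cos ((p - q : ℤ) * x) - Real.cos ((p + q : ℤ) * x)) / (2 * Real.pi) := by
      intro x
      simp only [basisFun, hp, hq, h1.not_gt, h2.not_gt, if_false, hdiv]
      push_cast
      rw [sub_mul, add_mul, Real.cos_sub, Real.cos_add, neg_mul, neg_mul, Real.sin_neg,
        Real.sin_neg]
      field_simp; ring
    simp_rw [this]
    rw [intervalIntegral.integral_div, intervalIntegral.integral_sub (ic _) (ic _),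
      integral_cos_int_mul, integral_cos_int_mul, if_neg (show p + q ≠ 0 by omega)]
    by_cases h : p = q
    · simp [h]
    · simp [h, sub_eq_zero]
  · have : ∀ x, basisFun p x * basisFun q x
        = (-Real.sin ((p + q : ℤ) * x) - Real.sin ((p - q : ℤ) * x)) / (2 * Real.pi) := by
      intro x
      simp only [basisFun, hp, hq, h1.not_gt, h2, if_false, if_true, hdiv]
      push_cast
      rw [sub_mul, add_mul, Real.sin_sub, Real.sin_add, neg_mul, Real.sin_neg]
      field_simp; ring
    simp_rw [this]
    rw [intervalIntegral.integral_div, intervalIntegral.integral_sub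
      (f := fun x => -Real.sin ((p + q : ℤ) * x)) (is _).neg (is _), intervalIntegral.integral_neg, integral_sin_int_mul, integral_sin_int_mul,
      if_neg (by omega)]
    simp
  · have : ∀ x, basisFun p x * basisFun q x
        = (Real.sin ((p - q : ℤ) * x) - Real.sin ((p + q : ℤ) * x)) / (2 * Real.pi) := by
      intro x
      simp only [basisFun, hp, hq, h1, h2.not_gt, if_false, if_true, hdiv]
      push_cast
      rw [sub_mul, add_mul, Real.sin_sub, Real.sin_add, neg_mul, Real.sin_neg]
      field_simp; ring
    simp_rw [this]
    rw [intervalIntegral.integral_div, intervalIntegral.integral_sub (is _) (is _),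
      integral_sin_int_mul, integral_sin_int_mul, if_neg (by omega)]
    simp
  · have : ∀ x, basisFun p x * basisFun q x
        = (Real.cos ((p - q : ℤ) * x) + Real.cos ((p + q : ℤ) * x)) / (2 * Real.pi) := by
      intro x
      simp only [basisFun, hp, hq, h1, h2, if_false, if_true, hdiv]
      push_cast
      rw [sub_mul, add_mul, Real.cos_sub, Real.cos_add]
      field_simp; ring
    simp_rw [this]
    rw [intervalIntegral.integral_div, intervalIntegral.integral_add (ic _) (ic _),
      integral_cos_int_mul, integral_cos_int_mul, if_neg (show p + q ≠ 0 by omega)]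
    by_cases h : p = q
    · simp [h]
    · simp [h, sub_eq_zero]

/-- Parseval's identity for a trigonometric sum with distinct wavenumbers and without mean. -/
lemma integral_sum_basisFun_sq {ι : Type*} [Fintype ι] (c : ι → ℝ) {σ : ι → ℤ}
    (hσ : Function.Injective σ) (hc : ∀ i, σ i = 0 → c i = 0) :
    ∫ x in (0 : ℝ)..2 * Real.pi, (∑ i, c i * basisFun (σ i) x) ^ 2 = ∑ i, c i ^ 2 := by
  simp_rw [sq, Finset.sum_mul_sum]
  rw [intervalIntegral.integral_finsetSum fun i _ =>
    (by fun_prop : Continuous _).intervalIntegrable _ _]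
  refine Finset.sum_congr rfl fun i _ => ?_
  rw [intervalIntegral.integral_finsetSum fun i _ =>
    (by fun_prop : Continuous _).intervalIntegrable _ _]
  rw [Finset.sum_eq_single i]
  · by_cases h : σ i = 0
    · simp [hc i h]
    · simp_rw [show ∀ x, c i * basisFun (σ i) x * (c i * basisFun (σ i) x)
        = c i * c i * (basisFun (σ i) x * basisFun (σ i) x) from fun x => by ring]
      rw [intervalIntegral.integral_const_mul, integral_basisFun_mul h h]; simp
  · intro j _ hj
    by_cases h : σ i = 0
    · simp [hc i h]
    by_cases h' : σ j = 0
    · simp [hc j h']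
    simp_rw [show ∀ x, c i * basisFun (σ i) x * (c j * basisFun (σ j) x)
        = c i * c j * (basisFun (σ i) x * basisFun (σ j) x) from fun x => by ring]
    rw [intervalIntegral.integral_const_mul, integral_basisFun_mul h h',
      if_neg fun e => hj (hσ e).symm, mul_zero]
  · simp

/-- The derivative of `toFun u`. -/
def derivFun (u : Coeff N) (x : ℝ) : ℝ :=
  ∑ n : Mode N, -((n : ℤ) : ℝ) * u n * basisFun (-(n : ℤ)) x

lemma hasDerivAt_toFun (u : Coeff N) (x : ℝ) : HasDerivAt (toFun u) (derivFun u x) x := by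
  have h := HasDerivAt.fun_sum (u := Finset.univ)
    (fun (n : Mode N) _ => (hasDerivAt_basisFun (n : ℤ) x).const_mul (u n))
  refine h.congr_deriv ?_
  exact Finset.sum_congr rfl fun n _ => by ring

lemma deriv_toFun (u : Coeff N) : deriv (toFun u) = derivFun u :=
  funext fun x => (hasDerivAt_toFun u x).deriv

@[fun_prop]
lemma continuous_toFun (u : Coeff N) : Continuous (toFun u) := by unfold toFun; fun_prop

@[fun_prop]
lemma continuous_derivFun (u : Coeff N) : Continuous (derivFun u) := by unfold derivFun; fun_prop

lemma toFun_periodic (u : Coeff N) : Function.Periodic (toFun u) (2 * Real.pi) := fun x => by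
  simp only [toFun, basisFun_periodic _ x]

lemma toFun_eq_mean_add (u : Coeff N) (x : ℝ) : toFun u x = mean u + toFun (perp u) x := by
  have h : ∀ n : Mode N, u n * basisFun n x =
      (if n = zeroMode N then mean u else 0) + perp u n * basisFun n x := by
    intro n
    by_cases hn : n = zeroMode N
    · subst hn; simp [perp, zeroMode, mean, basisFun_zero]
    · have : (n : ℤ) ≠ 0 := fun h => hn (Subtype.ext h)
      simp [perp, hn, this]
  unfold toFun
  rw [Finset.sum_congr rfl fun n _ => h n, Finset.sum_add_distrib]
  simp

/-- The derivative is a sum over the relabelled wavenumbers `-n`; this is why Parseval is stated for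
an injective family `σ`. -/
lemma integral_derivFun_sq (u : Coeff N) :
    ∫ x in (0 : ℝ)..2 * Real.pi, derivFun u x ^ 2 = ∑ n : Mode N, ((n : ℤ) : ℝ) ^ 2 * u n ^ 2 := by
  unfold derivFun
  rw [integral_sum_basisFun_sq (fun n : Mode N => -((n : ℤ) : ℝ) * u n)
    (σ := fun n : Mode N => -(n : ℤ)) (fun a b h => Subtype.ext (neg_injective h))
    (fun i hi => by simp [neg_eq_zero.1 hi])]
  exact Finset.sum_congr rfl fun n _ => by ring

lemma integral_toFun_perp_sq (u : Coeff N) :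
    ∫ x in (0 : ℝ)..2 * Real.pi, toFun (perp u) x ^ 2 = ∑ n : Mode N, perp u n ^ 2 := by
  unfold toFun
  exact integral_sum_basisFun_sq (perp u) (σ := fun n : Mode N => (n : ℤ))
    Subtype.val_injective (fun i hi => by simp [perp, hi])

lemma integral_toFun_perp (u : Coeff N) :
    ∫ x in (0 : ℝ)..2 * Real.pi, toFun (perp u) x = 0 := by
  unfold toFun
  rw [intervalIntegral.integral_finsetSum fun i _ =>
    (by fun_prop : Continuous _).intervalIntegrable _ _]
  refine Finset.sum_eq_zero fun n _ => ?_
  rw [intervalIntegral.integral_const_mul]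
  by_cases h : (n : ℤ) = 0
  · simp [perp, h]
  · rw [integral_basisFun h, mul_zero]

/-! ### Gaussian integrals -/

lemma integrable_exp_linear_sub_sq {a : ℝ} (ha : 0 < a) (b : ℝ) :
    Integrable fun x : ℝ => Real.exp (b * x - a * x ^ 2 / 2) := by
  have h := ((integrable_exp_neg_mul_sq (half_pos ha)).comp_sub_right (b / a)).const_mul
    (Real.exp (b ^ 2 / (2 * a)))
  refine h.congr (Filter.Eventually.of_forall fun x => ?_)
  simp only [← Real.exp_add]
  congr 1
  field_simp
  ring

lemma integral_exp_linear_sub_sq {a : ℝ} (ha : 0 < a) (b : ℝ) :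
    ∫ x : ℝ, Real.exp (b * x - a * x ^ 2 / 2)
      = √(2 * Real.pi / a) * Real.exp (b ^ 2 / (2 * a)) := by
  have h : ∀ x : ℝ, Real.exp (b * x - a * x ^ 2 / 2)
      = Real.exp (b ^ 2 / (2 * a)) * Real.exp (-(a / 2) * (x - b / a) ^ 2) := by
    intro x
    rw [← Real.exp_add]
    congr 1
    field_simp
    ring
  simp_rw [h]
  rw [integral_const_mul, integral_sub_right_eq_self (fun x => Real.exp (-(a / 2) * x ^ 2)),
    integral_gaussian, mul_comm]
  congr 2
  field_simp

/-- The unnormalized centred Gaussian density with precisions `a n`. -/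
def gaussDensity (a : ℤ → ℝ) (u : Coeff N) : ℝ :=
  Real.exp (-(∑ n : Mode N, a n * u n ^ 2 / 2))

/-- The total mass of `gaussDensity a`. -/
def gaussMass (N : ℕ) (a : ℤ → ℝ) : ℝ := ∏ n : Mode N, √(2 * Real.pi / a n)

lemma gaussMass_pos {a : ℤ → ℝ} (ha : ∀ n, 0 < a n) : 0 < gaussMass N a :=
  Finset.prod_pos fun n _ => Real.sqrt_pos.2 (div_pos (by positivity) (ha _))

lemma gaussDensity_pos (a : ℤ → ℝ) (u : Coeff N) : 0 < gaussDensity a u := Real.exp_pos _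

@[fun_prop]
lemma continuous_gaussDensity (a : ℤ → ℝ) : Continuous (gaussDensity (N := N) a) := by
  unfold gaussDensity; fun_prop

/-- The exponential moments of linear functionals under a product Gaussian. -/
lemma lintegral_exp_linear_mul_gaussDensity {a : ℤ → ℝ} (ha : ∀ n, 0 < a n) (b : Mode N → ℝ) :
    ∫⁻ u : Coeff N, ENNReal.ofReal (Real.exp (∑ n, b n * u n) * gaussDensity a u)
      = ENNReal.ofReal (gaussMass N a * Real.exp (∑ n, b n ^ 2 / (2 * a n))) := by
  have h : ∀ u : Coeff N, Real.exp (∑ n, b n * u n) * gaussDensity a u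
      = ∏ n : Mode N, Real.exp (b n * u n - a n * u n ^ 2 / 2) := by
    intro u
    rw [gaussDensity, ← Real.exp_add, ← Real.exp_sum, Finset.sum_sub_distrib, sub_eq_add_neg]
  simp_rw [h]
  rw [← ofReal_integral_eq_lintegral_ofReal]
  · congr 1
    rw [integral_fintype_prod_volume_eq_prod
      (f := fun (n : Mode N) (x : ℝ) => Real.exp (b n * x - a n * x ^ 2 / 2))]
    simp_rw [integral_exp_linear_sub_sq (ha _), Finset.prod_mul_distrib, Real.exp_sum]
    rfl
  · exact Integrable.fintype_prod
      (f := fun (n : Mode N) (x : ℝ) => Real.exp (b n * x - a n * x ^ 2 / 2))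
      fun n => integrable_exp_linear_sub_sq (ha _) _
  · exact Filter.Eventually.of_forall fun u => Finset.prod_nonneg fun n _ => (Real.exp_pos _).le

lemma lintegral_gaussDensity {a : ℤ → ℝ} (ha : ∀ n, 0 < a n) :
    ∫⁻ u : Coeff N, ENNReal.ofReal (gaussDensity a u) = ENNReal.ofReal (gaussMass N a) := by
  simpa using lintegral_exp_linear_mul_gaussDensity (N := N) ha 0

/-! ### Suprema of random trigonometric sums -/

/-- A Sobolev bound for `exp (l f)` on the circle. -/
lemma exp_toFun_le (v : Coeff N) {D : ℝ} (hD : 0 < D) (l x : ℝ) :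
    Real.exp (l * toFun v x) ≤ Real.exp (l * toFun v 0)
      + ∫ y in (0 : ℝ)..2 * Real.pi,
          D * (Real.exp (l * (toFun v y + derivFun v y / D))
            + Real.exp (l * (toFun v y - derivFun v y / D))) := by
  obtain ⟨y, ⟨hy0, hy1⟩, hy⟩ := (toFun_periodic v).exists_mem_Ico₀ (by positivity) x
  rw [hy]
  have hder : ∀ z ∈ Set.uIcc 0 y, HasDerivAt (fun z => Real.exp (l * toFun v z))
      (Real.exp (l * toFun v z) * (l * derivFun v z)) z :=
    fun z _ => ((hasDerivAt_toFun v z).const_mul l).exp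
  have hftc := intervalIntegral.integral_eq_sub_of_hasDerivAt hder
    ((by fun_prop : Continuous _).intervalIntegrable _ _)
  -- From `p ≤ exp p + exp (-p)`: the derivative factor is absorbed into exponentials of linear
  -- functionals of `v`, whose Gaussian integrals are explicit.
  have hle : ∀ z, Real.exp (l * toFun v z) * (l * derivFun v z)
      ≤ D * (Real.exp (l * (toFun v z + derivFun v z / D))
            + Real.exp (l * (toFun v z - derivFun v z / D))) := by
    intro z
    set p := l * derivFun v z / D with hp
    have e1 : l * (toFun v z + derivFun v z / D) = l * toFun v z + p := by rw [hp]; ring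
    have e2 : l * (toFun v z - derivFun v z / D) = l * toFun v z - p := by rw [hp]; ring
    have e3 : l * derivFun v z = D * p := by rw [hp]; field_simp
    rw [e1, e2, e3, sub_eq_add_neg, Real.exp_add, Real.exp_add, ← mul_add]
    have h1 : p ≤ Real.exp p + Real.exp (-p) := by
      have := Real.add_one_le_exp p
      have := Real.exp_pos (-p)
      linarith
    nlinarith [mul_le_mul_of_nonneg_left h1 (mul_pos hD (Real.exp_pos (l * toFun v z))).le]
  have hmono : ∫ z in (0 : ℝ)..y, Real.exp (l * toFun v z) * (l * derivFun v z)
      ≤ ∫ z in (0 : ℝ)..y, D * (Real.exp (l * (toFun v z + derivFun v z / D))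
            + Real.exp (l * (toFun v z - derivFun v z / D))) :=
    intervalIntegral.integral_mono_on hy0 ((by fun_prop : Continuous _).intervalIntegrable _ _)
      ((by fun_prop : Continuous _).intervalIntegrable _ _) fun z _ => hle z
  have hext : ∫ z in (0 : ℝ)..y, D * (Real.exp (l * (toFun v z + derivFun v z / D))
            + Real.exp (l * (toFun v z - derivFun v z / D)))
      ≤ ∫ z in (0 : ℝ)..2 * Real.pi, D * (Real.exp (l * (toFun v z + derivFun v z / D))
            + Real.exp (l * (toFun v z - derivFun v z / D))) :=
    intervalIntegral.integral_mono_interval le_rfl hy0 hy1.le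
      (Filter.Eventually.of_forall fun z => by positivity)
      ((by fun_prop : Continuous _).intervalIntegrable _ _)
  linarith

/-- The Fourier multiplier with symbol `m`. -/
def mulCoeff (m : ℤ → ℝ) (u : Coeff N) : Coeff N := fun n => m n * u n

lemma toFun_mulCoeff (m : ℤ → ℝ) (u : Coeff N) (x : ℝ) :
    toFun (mulCoeff m u) x = ∑ n : Mode N, m n * basisFun n x * u n :=
  Finset.sum_congr rfl fun n _ => by unfold mulCoeff; ring

lemma derivFun_mulCoeff (m : ℤ → ℝ) (u : Coeff N) (x : ℝ) :
    derivFun (mulCoeff m u) x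
      = ∑ n : Mode N, m n * (-((n : ℤ) : ℝ) * basisFun (-(n : ℤ)) x) * u n :=
  Finset.sum_congr rfl fun n _ => by unfold mulCoeff; ring

lemma lintegral_exp_mul_sum_le {a : ℤ → ℝ} (ha : ∀ n, 0 < a n) {m : ℤ → ℝ} {V : ℝ}
    (hV : ∑ n : Mode N, m n ^ 2 / a n ≤ V) (l : ℝ) {b : ℤ → ℝ}
    (hb : ∀ n, m n ≠ 0 → |b n| ≤ 2 / √Real.pi) :
    ∫⁻ u : Coeff N, ENNReal.ofReal
        (Real.exp (l * ∑ n : Mode N, m n * b n * u n) * gaussDensity a u)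
      ≤ ENNReal.ofReal (gaussMass N a * Real.exp (l ^ 2 * V)) := by
  have h := lintegral_exp_linear_mul_gaussDensity (N := N) ha (fun n => l * (m n * b n))
  have e : ∀ u : Coeff N, l * ∑ n : Mode N, m n * b n * u n
      = ∑ n : Mode N, l * (m n * b n) * u n := fun u => by
    rw [Finset.mul_sum]; exact Finset.sum_congr rfl fun n _ => by ring
  simp_rw [e, h]
  refine ENNReal.ofReal_le_ofReal (mul_le_mul_of_nonneg_left (Real.exp_le_exp.2 ?_)
    (gaussMass_pos ha).le)
  refine le_trans ?_ (mul_le_mul_of_nonneg_left hV (sq_nonneg l))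
  rw [Finset.mul_sum]
  refine Finset.sum_le_sum fun n _ => ?_
  by_cases hm : m n = 0
  · simp [hm]
  have h2 : b n ^ 2 ≤ 4 / Real.pi := by
    have := pow_le_pow_left₀ (abs_nonneg _) (hb n hm) 2
    rw [sq_abs, div_pow, Real.sq_sqrt Real.pi_pos.le] at this
    linarith
  -- The value `2` cancels the `2` in `b² / (2a)` and leaves the clean exponent `l² V`.
  have h3 : b n ^ 2 ≤ 2 := h2.trans (by rw [div_le_iff₀ Real.pi_pos]; linarith [Real.pi_gt_three])
  have ha' := ha n
  rw [div_le_iff₀ (by positivity)]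
  have : l ^ 2 * (m n ^ 2 / a n) * (2 * a n) = (l * m n) ^ 2 * 2 := by field_simp
  rw [this]
  nlinarith [mul_le_mul_of_nonneg_left h3 (sq_nonneg (l * m n))]

lemma lintegral_const_mul_add_le {α : Type*} [MeasurableSpace α] {μ : Measure α}
    {f g : α → ℝ≥0∞} (hf : Measurable f) (hg : Measurable g) {c E : ℝ} (hc : 0 ≤ c) (hE : 0 ≤ E)
    (h1 : ∫⁻ u, f u ∂μ ≤ ENNReal.ofReal E) (h2 : ∫⁻ u, g u ∂μ ≤ ENNReal.ofReal E) :
    ∫⁻ u, ENNReal.ofReal c * (f u + g u) ∂μ ≤ ENNReal.ofReal (c * (2 * E)) := by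
  have hfg : Measurable fun u => f u + g u := hf.add hg
  rw [lintegral_const_mul _ hfg, lintegral_add_left hf, ENNReal.ofReal_mul hc, two_mul E,
    ENNReal.ofReal_add hE hE]
  gcongr

/-- The exponential of `l (f + s f' / D)` at the point `y`, times the Gaussian density, where `f`
is `u` filtered by `m`. -/
def tiltedDensity (a m : ℤ → ℝ) (D l s : ℝ) (u : Coeff N) (y : ℝ) : ℝ≥0∞ :=
  ENNReal.ofReal (Real.exp (l * (toFun (mulCoeff m u) y + s * (derivFun (mulCoeff m u) y / D)))
    * gaussDensity a u)

lemma measurable_tiltedDensity_uncurry (a m : ℤ → ℝ) (D l s : ℝ) :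
    Measurable fun p : Coeff N × ℝ => tiltedDensity a m D l s p.1 p.2 := by
  unfold tiltedDensity toFun derivFun mulCoeff gaussDensity
  exact ENNReal.continuous_ofReal.measurable.comp
    (by fun_prop : Continuous _).measurable

lemma measurable_tiltedDensity (a m : ℤ → ℝ) (D l s y : ℝ) :
    Measurable fun u : Coeff N => tiltedDensity a m D l s u y :=
  Measurable.of_uncurry_right (f := tiltedDensity (N := N) a m D l s)
    (measurable_tiltedDensity_uncurry a m D l s)

/-- A Bernstein-type effect: on the support of `m` one has `|n| ≤ D`, so the coefficients of `f' /
D` obey the same bound `1/√π` as those of `f`, and their sum obeys `2/√π`. -/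
lemma lintegral_tiltedDensity_le {a : ℤ → ℝ} (ha : ∀ n, 0 < a n) {m : ℤ → ℝ} {V D : ℝ}
    (hD : 0 < D) (hm : ∀ n, m n ≠ 0 → n ≠ 0 ∧ |(n : ℝ)| ≤ D)
    (hV : ∑ n : Mode N, m n ^ 2 / a n ≤ V) (l : ℝ) {s : ℝ} (hs : |s| ≤ 1) (y : ℝ) :
    ∫⁻ u : Coeff N, tiltedDensity a m D l s u y
      ≤ ENNReal.ofReal (gaussMass N a * Real.exp (l ^ 2 * V)) := by
  have e : ∀ u : Coeff N, toFun (mulCoeff m u) y + s * (derivFun (mulCoeff m u) y / D)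
      = ∑ n : Mode N, m n * (basisFun n y
          + s * (-((n : ℤ) : ℝ) * basisFun (-(n : ℤ)) y / D)) * u n := by
    intro u
    rw [toFun_mulCoeff, derivFun_mulCoeff, Finset.sum_div, Finset.mul_sum,
      ← Finset.sum_add_distrib]
    exact Finset.sum_congr rfl fun n _ => by ring
  simp_rw [tiltedDensity, e]
  refine lintegral_exp_mul_sum_le ha hV l
    (b := fun n => basisFun n y + s * (-(n : ℝ) * basisFun (-n) y / D)) fun n hn => ?_
  obtain ⟨hn0, hnD⟩ := hm n hn
  have b1 := abs_basisFun_le hn0 y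
  have b2 := abs_basisFun_le (neg_ne_zero.2 hn0) y
  have b3 : |-(n : ℝ) * basisFun (-n) y / D| ≤ 1 / √Real.pi := by
    rw [abs_div, abs_mul, abs_neg, abs_of_pos hD, div_le_iff₀ hD, mul_comm (1 / _)]
    exact mul_le_mul hnD b2 (abs_nonneg _) hD.le
  have b4 : |s * (-(n : ℝ) * basisFun (-n) y / D)| ≤ 1 / √Real.pi := by
    rw [abs_mul]
    exact (mul_le_of_le_one_left (abs_nonneg _) hs).trans b3
  exact (abs_add_le _ _).trans ((add_le_add b1 b4).trans (le_of_eq (by ring)))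

/-- A majorant of `exp (l f)`, uniform in the point, where `f` is `u` filtered by `m`. -/
def expMajorant (a m : ℤ → ℝ) (D l : ℝ) (u : Coeff N) : ℝ≥0∞ :=
  tiltedDensity a m D l 0 u 0 + ∫⁻ y in Set.Ioc 0 (2 * Real.pi), ENNReal.ofReal D *
    (tiltedDensity a m D l 1 u y + tiltedDensity a m D l (-1) u y)

lemma measurable_expMajorant (a m : ℤ → ℝ) (D l : ℝ) :
    Measurable (expMajorant (N := N) a m D l) := by
  have h := fun s => measurable_tiltedDensity_uncurry (N := N) a m D l s
  exact (measurable_tiltedDensity a m D l 0 0).add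
    (Measurable.lintegral_prod_right' (((h 1).add (h (-1))).const_mul (ENNReal.ofReal D)))

lemma le_expMajorant (a m : ℤ → ℝ) {D : ℝ} (hD : 0 < D) (l : ℝ) (u : Coeff N) (x : ℝ) :
    ENNReal.ofReal (Real.exp (l * toFun (mulCoeff m u) x) * gaussDensity a u)
      ≤ expMajorant a m D l u := by
  have hg := (gaussDensity_pos a u).le
  have h := mul_le_mul_of_nonneg_right (exp_toFun_le (mulCoeff m u) hD l x) hg
  refine (ENNReal.ofReal_le_ofReal h).trans ?_
  rw [add_mul, ENNReal.ofReal_add (by positivity)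
    (mul_nonneg (intervalIntegral.integral_nonneg (by positivity) fun y _ => by positivity) hg)]
  refine add_le_add (le_of_eq ?_) (le_of_eq ?_)
  · simp [tiltedDensity]
  rw [← intervalIntegral.integral_mul_const,
    intervalIntegral.integral_of_le (by positivity), ofReal_integral_eq_lintegral_ofReal]
  · refine lintegral_congr fun y => ?_
    rw [mul_assoc, ENNReal.ofReal_mul hD.le, add_mul, ENNReal.ofReal_add (by positivity)
      (by positivity)]
    simp [tiltedDensity, sub_eq_add_neg]
  · exact (Continuous.intervalIntegrable (by fun_prop) 0 (2 * Real.pi)).1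
  · exact Filter.Eventually.of_forall fun y => by positivity

lemma lintegral_expMajorant_le {a : ℤ → ℝ} (ha : ∀ n, 0 < a n) {m : ℤ → ℝ} {V D : ℝ}
    (hD : 0 < D) (hm : ∀ n, m n ≠ 0 → n ≠ 0 ∧ |(n : ℝ)| ≤ D)
    (hV : ∑ n : Mode N, m n ^ 2 / a n ≤ V) (l : ℝ) :
    ∫⁻ u : Coeff N, expMajorant a m D l u
      ≤ ENNReal.ofReal ((1 + 4 * Real.pi * D) * (gaussMass N a * Real.exp (l ^ 2 * V))) := by
  have hZ := gaussMass_pos (N := N) ha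
  have h1 : ∀ (s : ℝ), |s| ≤ 1 → ∀ y, _ :=
    fun s hs y => lintegral_tiltedDensity_le (N := N) ha hD hm hV l hs y
  set E := gaussMass N a * Real.exp (l ^ 2 * V) with hE
  have hE0 : 0 ≤ E := by positivity
  unfold expMajorant
  have hmeas := fun s => measurable_tiltedDensity_uncurry (N := N) a m D l s
  rw [lintegral_add_left (measurable_tiltedDensity a m D l 0 0),
    lintegral_lintegral_swap (((hmeas 1).add (hmeas (-1))).const_mul _).aemeasurable]
  have h2 : ∀ y, _ ≤ ENNReal.ofReal (D * (2 * E)) := fun y =>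
    lintegral_const_mul_add_le (measurable_tiltedDensity a m D l 1 y)
      (measurable_tiltedDensity a m D l (-1) y) hD.le hE0 (h1 1 (by simp) y) (h1 (-1) (by simp) y)
  refine (add_le_add (h1 0 (by simp) 0) (lintegral_mono h2)).trans ?_
  have h3 : 0 ≤ D * (2 * E) := by positivity
  rw [lintegral_const, Measure.restrict_apply_univ, Real.volume_Ioc, sub_zero,
    ← ENNReal.ofReal_mul h3, ← ENNReal.ofReal_add hE0 (by positivity)]
  exact ENNReal.ofReal_le_ofReal (le_of_eq (by ring))

/-- A sub-Gaussian tail bound for the supremum of a filtered Gaussian trigonometric sum. -/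
lemma lintegral_sup_ge_le {a : ℤ → ℝ} (ha : ∀ n, 0 < a n) {m : ℤ → ℝ} {V D t : ℝ}
    (hD : 0 < D) (hm : ∀ n, m n ≠ 0 → n ≠ 0 ∧ |(n : ℝ)| ≤ D)
    (hV : ∑ n : Mode N, m n ^ 2 / a n ≤ V) (hV0 : 0 < V) (ht : 0 ≤ t) :
    ∫⁻ u in {u : Coeff N | ∃ x, t ≤ |toFun (mulCoeff m u) x|}, ENNReal.ofReal (gaussDensity a u)
      ≤ ENNReal.ofReal (2 * (1 + 4 * Real.pi * D) * Real.exp (-(t ^ 2 / (4 * V)))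
          * gaussMass N a) := by
  have hZ := gaussMass_pos (N := N) ha
  -- The optimal Chernoff parameter: it minimizes `-l t + l² V`, with value `-t²/(4V)`.
  set l := t / (2 * V) with hl
  have hl0 : 0 ≤ l := by positivity
  have key : ∀ u ∈ {u : Coeff N | ∃ x, t ≤ |toFun (mulCoeff m u) x|},
      ENNReal.ofReal (gaussDensity a u) ≤ ENNReal.ofReal (Real.exp (-(l * t))) *
        (expMajorant a m D l u + expMajorant a m D (-l) u) := by
    rintro u ⟨x, hx⟩
    have hg := (gaussDensity_pos a u)
    have aux : ∀ l', l * t ≤ l' * toFun (mulCoeff m u) x →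
        ENNReal.ofReal (gaussDensity a u) ≤ ENNReal.ofReal (Real.exp (-(l * t))) *
          expMajorant a m D l' u := by
      intro l' h'
      refine le_trans ?_ (mul_le_mul_right (le_expMajorant a m hD l' u x) _)
      rw [← ENNReal.ofReal_mul (Real.exp_pos _).le, ← mul_assoc, ← Real.exp_add]
      refine ENNReal.ofReal_le_ofReal (le_mul_of_one_le_left hg.le (Real.one_le_exp (by linarith)))
    rcases le_abs.1 hx with h | h
    · exact (aux l (mul_le_mul_of_nonneg_left h hl0)).trans (by gcongr; exact le_self_add)
    · refine (aux (-l) ?_).trans (by gcongr; exact le_add_self)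
      have := mul_le_mul_of_nonneg_left h hl0
      linarith
  have hmeas := fun l => measurable_expMajorant (N := N) a m D l
  calc ∫⁻ u in {u : Coeff N | ∃ x, t ≤ |toFun (mulCoeff m u) x|}, ENNReal.ofReal (gaussDensity a u)
      ≤ ∫⁻ u : Coeff N, ENNReal.ofReal (Real.exp (-(l * t))) *
        (expMajorant a m D l u + expMajorant a m D (-l) u) := by
        -- Only the majorant has to be measurable here, not the event, which is a union over
        -- uncountably many `x`.
        refine (setLIntegral_mono (((hmeas l).add (hmeas (-l))).const_mul _) key).trans ?_
        exact lintegral_mono' Measure.restrict_le_self le_rfl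
    _ ≤ ENNReal.ofReal (Real.exp (-(l * t)) *
        (2 * ((1 + 4 * Real.pi * D) * (gaussMass N a * Real.exp (l ^ 2 * V))))) := by
        refine lintegral_const_mul_add_le (hmeas l) (hmeas (-l)) (Real.exp_pos _).le (by positivity)
          (lintegral_expMajorant_le ha hD hm hV l) ?_
        have := lintegral_expMajorant_le (N := N) ha hD hm hV (-l)
        rwa [neg_sq] at this
    _ = _ := by
        congr 1
        have : Real.exp (-(t ^ 2 / (4 * V))) = Real.exp (-(l * t)) * Real.exp (l ^ 2 * V) := by
          rw [← Real.exp_add]; congr 1; rw [hl]; field_simp; ring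
        rw [this]; ring

/-! ### Littlewood-Paley blocks -/

lemma abs_blockMultiplier_le {θ : ℝ → ℝ} (hθ : IsDyadicCutoff θ) (j : ℕ) (ξ : ℝ) :
    |blockMultiplier θ j ξ| ≤ 1 := by
  unfold blockMultiplier
  have h1 := hθ.mem_Icc
  split_ifs
  · exact abs_le.2 ⟨by linarith [(h1 ξ).1], (h1 ξ).2⟩
  · have h2 := h1 (ξ / 2 ^ j)
    have h3 := h1 (ξ / 2 ^ (j - 1))
    exact abs_le.2 ⟨by linarith [h2.1, h3.2], by linarith [h2.2, h3.1]⟩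

/-- Blocks are supported on dyadic annuli (away from the wavenumber `0`). -/
lemma exists_annulus {θ : ℝ → ℝ} (hθ : IsDyadicCutoff θ) :
    ∃ c₁ : ℝ, 0 < c₁ ∧ ∃ c₂ : ℝ, 1 ≤ c₂ ∧ ∀ (j : ℕ) (n : ℤ), n ≠ 0 →
      blockMultiplier θ j n ≠ 0 → c₁ * 2 ^ j ≤ |(n : ℝ)| ∧ |(n : ℝ)| ≤ c₂ * 2 ^ j := by
  obtain ⟨a, ha, ha1⟩ := hθ.eq_one
  obtain ⟨b, hb⟩ := hθ.eq_zero
  -- For `j ≥ 1`, both cutoffs equal `1` once `|n| ≤ a 2^(j-1) = (a/2) 2^j`. For `j = 0` the lower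
  -- bound is just `|n| ≥ 1`, hence the minimum with `1`.
  refine ⟨min (a / 2) 1, by positivity, max b 1, le_max_right _ _, fun j n hn h => ?_⟩
  have hn1 : (1 : ℝ) ≤ |(n : ℝ)| := by exact_mod_cast Int.one_le_abs hn
  unfold blockMultiplier at h
  split_ifs at h with hj
  · subst hj
    refine ⟨by simpa using Or.inr hn1, ?_⟩
    by_contra hc
    exact h (hb _ (by have := le_max_left b 1; simp only [pow_zero, mul_one] at hc; linarith))
  · obtain ⟨i, rfl⟩ : ∃ i, j = i + 1 := ⟨j - 1, by omega⟩
    simp only [Nat.add_sub_cancel] at h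
    have hp : (0 : ℝ) < 2 ^ i := by positivity
    have hp1 : (0 : ℝ) < 2 ^ (i + 1) := by positivity
    have habs : ∀ i : ℕ, |(n : ℝ) / 2 ^ i| = |(n : ℝ)| / 2 ^ i := fun i => by
      rw [abs_div, abs_of_pos (show (0 : ℝ) < 2 ^ i by positivity)]
    have hle : |(n : ℝ)| / 2 ^ (i + 1) ≤ |(n : ℝ)| / 2 ^ i :=
      div_le_div_of_nonneg_left (abs_nonneg _) hp (by rw [pow_succ]; linarith)
    constructor
    · by_contra hc
      push Not at hc
      have h1 : |(n : ℝ)| / 2 ^ i ≤ a := by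
        rw [div_le_iff₀ hp]
        have := mul_le_mul_of_nonneg_right (min_le_left (a / 2) 1) hp1.le
        have e : a / 2 * 2 ^ (i + 1) = a * 2 ^ i := by rw [pow_succ]; ring
        linarith
      rw [ha1 _ (by rw [habs]; exact hle.trans h1), ha1 _ (by rw [habs]; exact h1)] at h
      exact h (sub_self _)
    · by_contra hc
      push Not at hc
      have h1 : b ≤ |(n : ℝ)| / 2 ^ (i + 1) := by
        rw [le_div_iff₀ hp1]
        have := mul_le_mul_of_nonneg_right (le_max_left b 1) hp1.le
        linarith
      rw [hb _ (by rw [habs]; exact h1), hb _ (by rw [habs]; exact h1.trans hle)] at h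
      exact h (sub_self _)

/-- The multiplier of a block on functions without mean. -/
def perpMultiplier (θ : ℝ → ℝ) (j : ℕ) (n : ℤ) : ℝ := if n = 0 then 0 else blockMultiplier θ j n

lemma block_perp (θ : ℝ → ℝ) (j : ℕ) (u : Coeff N) (x : ℝ) :
    block θ j (perp u) x = toFun (mulCoeff (perpMultiplier θ j) u) x := by
  unfold block toFun mulCoeff perp perpMultiplier
  refine Finset.sum_congr rfl fun n _ => ?_
  split_ifs <;> simp

/-- This bounds the variance of a block at frequency `q`: at most `2c₂q + 1 ≤ 3c₂q` modes, each
contributing at most `2ε/(c₁q)²`. -/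
lemma sum_annulus_le {a : ℤ → ℝ} {ε : ℝ} (hε : 0 < ε) {m : ℤ → ℝ} (hm1 : ∀ n, |m n| ≤ 1)
    {c₁ c₂ q : ℝ} (hc₁ : 0 < c₁) (hc₂ : 1 ≤ c₂) (hq : 1 ≤ q)
    (hm : ∀ n, m n ≠ 0 → n ≠ 0 ∧ c₁ * q ≤ |(n : ℝ)| ∧ |(n : ℝ)| ≤ c₂ * q)
    (ha : ∀ n : ℤ, n ≠ 0 → (n : ℝ) ^ 2 / (2 * ε) ≤ a n) :
    ∑ n : Mode N, m n ^ 2 / a n ≤ 6 * c₂ / c₁ ^ 2 * ε / q := by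
  have hq0 : 0 < q := by linarith
  have hD1 : 1 ≤ c₂ * q := by nlinarith
  set M := ⌊c₂ * q⌋ with hM
  have hM1 : (1 : ℤ) ≤ M := Int.le_floor.2 (by simpa using hD1)
  have hterm : ∀ n : ℤ, m n ^ 2 / a n
      ≤ if n ∈ Finset.Icc (-M) M then 2 * ε / (c₁ * q) ^ 2 else 0 := by
    intro n
    by_cases h0 : m n = 0
    · simp only [h0]
      split_ifs
      · simp; positivity
      · simp
    obtain ⟨hn0, h1, h2⟩ := hm n h0
    have hmem : n ∈ Finset.Icc (-M) M := by
      rw [Finset.mem_Icc, ← abs_le]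
      exact Int.le_floor.2 (by exact_mod_cast h2)
    rw [if_pos hmem]
    have hsq : (c₁ * q) ^ 2 ≤ (n : ℝ) ^ 2 := by
      rw [← sq_abs (n : ℝ)]; exact pow_le_pow_left₀ (by positivity) h1 2
    have ha2 : (c₁ * q) ^ 2 / (2 * ε) ≤ a n := le_trans (by gcongr) (ha n hn0)
    have hm2 : m n ^ 2 ≤ 1 := by
      rw [← sq_abs]; exact pow_le_one₀ (abs_nonneg _) (hm1 n)
    calc m n ^ 2 / a n ≤ 1 / ((c₁ * q) ^ 2 / (2 * ε)) := by gcongr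
      _ = 2 * ε / (c₁ * q) ^ 2 := by field_simp
  calc ∑ n : Mode N, m n ^ 2 / a n
      ≤ ∑ n : Mode N, if (n : ℤ) ∈ Finset.Icc (-M) M then 2 * ε / (c₁ * q) ^ 2 else 0 :=
        Finset.sum_le_sum fun n _ => hterm n
    _ = ∑ n ∈ Finset.Icc (-(N : ℤ)) N,
          if n ∈ Finset.Icc (-M) M then 2 * ε / (c₁ * q) ^ 2 else 0 :=
        Finset.sum_coe_sort (Finset.Icc (-(N : ℤ)) (N : ℤ))
          fun n => if n ∈ Finset.Icc (-M) M then 2 * ε / (c₁ * q) ^ 2 else 0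
    _ ≤ ∑ n ∈ Finset.Icc (-M) M, 2 * ε / (c₁ * q) ^ 2 := by
        rw [← Finset.sum_filter]
        exact Finset.sum_le_sum_of_subset_of_nonneg
          (fun n hn => (Finset.mem_filter.1 hn).2) fun n _ _ => by positivity
    _ ≤ 3 * (c₂ * q) * (2 * ε / (c₁ * q) ^ 2) := by
        rw [Finset.sum_const, nsmul_eq_mul]
        gcongr
        rw [Int.card_Icc]
        have h1 : ((M + 1 - -M).toNat : ℤ) = 2 * M + 1 := by omega
        have h2 : ((M + 1 - -M).toNat : ℝ) = 2 * M + 1 := by exact_mod_cast h1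
        rw [h2]
        have : (M : ℝ) ≤ c₂ * q := Int.floor_le _
        linarith
    _ = 6 * c₂ / c₁ ^ 2 * ε / q := by field_simp; ring

/-- Gaussian tail of the Besov-Hölder norm, uniformly in the truncation. -/
theorem exists_besovHolderNorm_tail {κ : ℝ} (hκ : 0 < κ) (hκ' : κ < 1 / 2) {θ : ℝ → ℝ}
    (hθ : IsDyadicCutoff θ) :
    ∃ cmin : ℝ, 0 < cmin ∧ ∃ K : ℝ, 0 < K ∧ ∀ c₀ : ℝ, cmin ≤ c₀ → ∀ ε : ℝ, 0 < ε →
      1 ≤ Real.log (1 / ε) → ∀ (N : ℕ) (a : ℤ → ℝ), (∀ n, 0 < a n) →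
      (∀ n : ℤ, n ≠ 0 → (n : ℝ) ^ 2 / (2 * ε) ≤ a n) →
      ∫⁻ u in {u : Coeff N | ENNReal.ofReal (√(c₀ * ε * Real.log (1 / ε)))
          ≤ besovHolderNorm θ (1 / 2 - κ) (perp u)}, ENNReal.ofReal (gaussDensity a u)
        ≤ ENNReal.ofReal (K * ε * gaussMass N a) := by
  obtain ⟨c₁, hc₁, c₂, hc₂, hann⟩ := exists_annulus hθ
  have hlog2 : 0 < Real.log 2 := Real.log_pos (by norm_num)
  set S := 6 * c₂ / c₁ ^ 2 with hS
  have hS0 : 0 < S := by positivity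
  -- The threshold on `c₀` makes the sub-Gaussian exponent of block `j` at least `L + 2 j log 2`.
  -- The summand `1` pays for `L`, and `1/κ` compensates the slow growth `2κj log 2`.
  refine ⟨16 * S * (1 + 1 / κ), by positivity, 4 * (1 + 4 * Real.pi * c₂), by positivity,
    fun c₀ hc₀ ε hε hL N a ha ha2 => ?_⟩
  set L := Real.log (1 / ε) with hLdef
  set R := √(c₀ * ε * L) with hR
  have hc₀pos : 0 < c₀ := lt_of_lt_of_le (by positivity) hc₀
  have hR0 : 0 < R := Real.sqrt_pos.2 (by positivity)
  have hRsq : R ^ 2 = c₀ * ε * L := Real.sq_sqrt (by positivity)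
  have hexpL : Real.exp (-L) = ε := by
    rw [hLdef, one_div, Real.log_inv, neg_neg, Real.exp_log hε]
  have hZ := gaussMass_pos (N := N) ha
  -- `R` is halved because a supremum that is at least `R` need not be attained, whereas some block
  -- and some point do exceed `R/2`.
  set t : ℕ → ℝ := fun j => R / 2 / 2 ^ (((j : ℝ) - 1) * (1 / 2 - κ)) with ht
  have hsub : {u : Coeff N | ENNReal.ofReal R ≤ besovHolderNorm θ (1 / 2 - κ) (perp u)}
      ⊆ ⋃ j : ℕ, {u : Coeff N | ∃ x, t j ≤ |toFun (mulCoeff (perpMultiplier θ j) u) x|} := by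
    intro u hu
    have h1 : ENNReal.ofReal (R / 2) < besovHolderNorm θ (1 / 2 - κ) (perp u) :=
      lt_of_lt_of_le ((ENNReal.ofReal_lt_ofReal_iff hR0).2 (by linarith)) hu
    unfold besovHolderNorm at h1
    obtain ⟨j, h1⟩ := lt_iSup_iff.1 h1
    obtain ⟨x, h1⟩ := lt_iSup_iff.1 h1
    refine Set.mem_iUnion.2 ⟨j, x, ?_⟩
    have h2 := (ENNReal.ofReal_lt_ofReal_iff_of_nonneg (by positivity)).1 h1
    rw [block_perp] at h2
    simp only [ht]
    rw [div_le_iff₀ (by positivity), mul_comm]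
    exact h2.le
  have hj : ∀ j : ℕ,
      ∫⁻ u in {u : Coeff N | ∃ x, t j ≤ |toFun (mulCoeff (perpMultiplier θ j) u) x|},
        ENNReal.ofReal (gaussDensity a u)
      ≤ ENNReal.ofReal (2 * (1 + 4 * Real.pi * c₂) * ε * gaussMass N a * (1 / 2) ^ j) := by
    intro j
    have hq1 : (1 : ℝ) ≤ 2 ^ j := one_le_pow₀ (by norm_num)
    have hq0 : (0 : ℝ) < 2 ^ j := by positivity
    have hmul : ∀ n, perpMultiplier θ j n ≠ 0 →
        n ≠ 0 ∧ c₁ * 2 ^ j ≤ |(n : ℝ)| ∧ |(n : ℝ)| ≤ c₂ * 2 ^ j := by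
      intro n hn
      unfold perpMultiplier at hn
      split_ifs at hn with h0
      · exact absurd rfl hn
      · exact ⟨h0, hann j n h0 hn⟩
    have hm1 : ∀ n, |perpMultiplier θ j n| ≤ 1 := by
      intro n
      unfold perpMultiplier
      split_ifs
      · simp
      · exact abs_blockMultiplier_le hθ j n
    have hV := sum_annulus_le (N := N) hε hm1 hc₁ hc₂ hq1 hmul ha2
    rw [← hS] at hV
    refine (lintegral_sup_ge_le ha (D := c₂ * 2 ^ j) (t := t j) (by positivity)
      (fun n hn => ⟨(hmul n hn).1, (hmul n hn).2.2⟩) hV (by positivity) (by positivity)).trans ?_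
    refine ENNReal.ofReal_le_ofReal ?_
    -- `exp (-L)` is the factor `ε`. Of the remaining `4^(-j)`, one `2^(-j)` cancels the frequency
    -- prefactor `D = c₂ 2^j` and the other makes the series over blocks converge.
    have hexp : L + 2 * Real.log 2 * j ≤ t j ^ 2 / (4 * (S * ε / 2 ^ j)) := by
      have e1 : t j ^ 2 / (4 * (S * ε / 2 ^ j)) = c₀ / (16 * S) * L *
          (2 ^ j / (2 ^ (((j : ℝ) - 1) * (1 / 2 - κ))) ^ 2) := by
        simp only [ht]
        rw [div_pow, div_pow, hRsq]
        field_simp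
        norm_num
      -- The loss `κ` of regularity below `1/2` leaves the growing factor `2^(2κj)`, which is what
      -- makes all blocks summable.
      have e2 : (2 : ℝ) ^ j / (2 ^ (((j : ℝ) - 1) * (1 / 2 - κ))) ^ 2
          = Real.exp (Real.log 2 * (2 * κ * j + (1 - 2 * κ))) := by
        rw [← Real.rpow_natCast 2 j, ← Real.rpow_natCast _ 2, ← Real.rpow_mul (by norm_num),
          ← Real.rpow_sub (by norm_num), Real.rpow_def_of_pos (by norm_num)]
        congr 1
        push_cast
        ring
      have e3 : 1 + Real.log 2 * (2 * κ * j) ≤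
          Real.exp (Real.log 2 * (2 * κ * j + (1 - 2 * κ))) := by
        have := Real.add_one_le_exp (Real.log 2 * (2 * κ * j + (1 - 2 * κ)))
        have h2 : 0 ≤ Real.log 2 * (1 - 2 * κ) := mul_nonneg hlog2.le (by linarith)
        linarith
      have e4 : 1 + 1 / κ ≤ c₀ / (16 * S) := by
        rw [le_div_iff₀ (by positivity)]; linarith
      rw [e1, e2]
      have hj0 : (0 : ℝ) ≤ j := j.cast_nonneg
      have e5 : 0 ≤ Real.log 2 * (2 * κ * j) := by positivity
      calc L + 2 * Real.log 2 * j ≤ L + L * (2 * Real.log 2 * j) := by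
            have : 0 ≤ 2 * Real.log 2 * j := by positivity
            nlinarith
        _ ≤ (1 + 1 / κ) * L * (1 + Real.log 2 * (2 * κ * j)) := by
            have : (1 + 1 / κ) * L * (1 + Real.log 2 * (2 * κ * j))
              = L + L * (2 * Real.log 2 * j) + L * (1 / κ + Real.log 2 * (2 * κ * j)) := by
              field_simp; ring
            rw [this]
            have : 0 ≤ L * (1 / κ + Real.log 2 * (2 * κ * j)) := by positivity
            linarith
        _ ≤ c₀ / (16 * S) * L * (1 + Real.log 2 * (2 * κ * j)) := by gcongr
        _ ≤ _ := by gcongr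
    have hexp2 : Real.exp (-(t j ^ 2 / (4 * (S * ε / 2 ^ j)))) ≤ ε * ((1 / 2) ^ j * (1 / 2) ^ j) := by
      refine (Real.exp_le_exp.2 (neg_le_neg hexp)).trans (le_of_eq ?_)
      rw [neg_add, Real.exp_add, hexpL]
      congr 1
      rw [← mul_pow, show -(2 * Real.log 2 * (j : ℝ)) = j * (-Real.log 2 + -Real.log 2) by ring,
        Real.exp_nat_mul, Real.exp_add, Real.exp_neg, Real.exp_log (by norm_num)]
      norm_num
    calc 2 * (1 + 4 * Real.pi * (c₂ * 2 ^ j)) * Real.exp (-(t j ^ 2 / (4 * (S * ε / 2 ^ j))))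
          * gaussMass N a
        ≤ 2 * ((1 + 4 * Real.pi * c₂) * 2 ^ j) * (ε * ((1 / 2) ^ j * (1 / 2) ^ j))
          * gaussMass N a := by
          gcongr
          have : 0 < Real.pi * c₂ := by positivity
          nlinarith
      _ = 2 * (1 + 4 * Real.pi * c₂) * ε * gaussMass N a * ((2 * (1 / 2)) ^ j * (1 / 2) ^ j) := by
          rw [mul_pow]; ring
      _ = _ := by norm_num
  calc _ ≤ ∫⁻ u in ⋃ j : ℕ, {u : Coeff N | ∃ x, t j ≤ |toFun (mulCoeff (perpMultiplier θ j) u) x|},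
        ENNReal.ofReal (gaussDensity a u) := lintegral_mono_set hsub
    _ ≤ ∑' j : ℕ, ∫⁻ u in {u : Coeff N | ∃ x, t j ≤ |toFun (mulCoeff (perpMultiplier θ j) u) x|},
        ENNReal.ofReal (gaussDensity a u) := lintegral_iUnion_le _ _
    _ ≤ ∑' j : ℕ, ENNReal.ofReal (2 * (1 + 4 * Real.pi * c₂) * ε * gaussMass N a * (1 / 2) ^ j) :=
        ENNReal.tsum_le_tsum hj
    _ = _ := by
        rw [← ENNReal.ofReal_tsum_of_nonneg (fun j => by positivity)
          (summable_geometric_two.mul_left _), tsum_mul_left, tsum_geometric_two]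
        congr 1
        ring

/-! ### Sup-norm control by the Besov-Hölder norm -/

lemma sum_blockMultiplier (θ : ℝ → ℝ) (J : ℕ) (ξ : ℝ) :
    ∑ j ∈ Finset.range (J + 1), blockMultiplier θ j ξ = θ (ξ / 2 ^ J) := by
  induction J with
  | zero => simp [blockMultiplier]
  | succ J ih => rw [Finset.sum_range_succ, ih]; simp [blockMultiplier]

/-- The blocks telescope to `θ (n / 2^J)`, which is `1` for all `|n| ≤ N` when `J` is large. The
dependence of `J` on `N` is harmless, since the block bounds are later summed as a geometric series.
-/
lemma exists_sum_block_eq {θ : ℝ → ℝ} (hθ : IsDyadicCutoff θ) (N : ℕ) :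
    ∃ J : ℕ, ∀ (u : Coeff N) (x : ℝ), toFun u x = ∑ j ∈ Finset.range (J + 1), block θ j u x := by
  obtain ⟨a, ha, ha1⟩ := hθ.eq_one
  obtain ⟨J, hJ⟩ := pow_unbounded_of_one_lt ((N : ℝ) / a) one_lt_two
  refine ⟨J, fun u x => ?_⟩
  unfold block toFun
  rw [Finset.sum_comm]
  refine Finset.sum_congr rfl fun n _ => ?_
  rw [← Finset.sum_mul, ← Finset.sum_mul, sum_blockMultiplier, ha1, one_mul]
  have hp : (0 : ℝ) < 2 ^ J := by positivity
  have hn : |((n : ℤ) : ℝ)| ≤ N := by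
    have := Finset.mem_Icc.1 n.2
    exact_mod_cast abs_le.2 this
  rw [abs_div, abs_of_pos hp, div_le_iff₀ hp]
  rw [div_lt_iff₀ ha] at hJ
  linarith

lemma abs_block_le_of_besovHolderNorm_le {θ : ℝ → ℝ} {s R : ℝ} (hR : 0 ≤ R) {u : Coeff N}
    (hu : besovHolderNorm θ s u ≤ ENNReal.ofReal R) (j : ℕ) (x : ℝ) :
    |block θ j u x| ≤ R * 2 ^ s * (2 ^ (-s)) ^ j := by
  have h1 : ENNReal.ofReal ((2 : ℝ) ^ (((j : ℝ) - 1) * s) * |block θ j u x|) ≤ ENNReal.ofReal R :=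
    le_trans (le_iSup₂ (f := fun (j : ℕ) (x : ℝ) =>
      ENNReal.ofReal ((2 : ℝ) ^ (((j : ℝ) - 1) * s) * |block θ j u x|)) j x) hu
  have h2 := (ENNReal.ofReal_le_ofReal_iff hR).1 h1
  have e : (2 : ℝ) ^ s * (2 ^ (-s)) ^ j = (2 ^ (((j : ℝ) - 1) * s))⁻¹ := by
    rw [← Real.rpow_natCast, ← Real.rpow_mul (by norm_num), ← Real.rpow_add (by norm_num),
      ← Real.rpow_neg (by norm_num)]
    congr 1; ring
  rw [mul_assoc, e, ← div_eq_mul_inv, le_div_iff₀ (by positivity)]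
  linarith

/-- The Besov-Hölder norm of positive regularity controls the sup norm. -/
lemma exists_abs_toFun_le {θ : ℝ → ℝ} (hθ : IsDyadicCutoff θ) {s : ℝ} (hs : 0 < s) :
    ∃ G : ℝ, 0 < G ∧ ∀ (N : ℕ) (R : ℝ), 0 ≤ R → ∀ u : Coeff N,
      besovHolderNorm θ s u ≤ ENNReal.ofReal R → ∀ x, |toFun u x| ≤ G * R := by
  have h0 : (0 : ℝ) < 2 ^ (-s) := by positivity
  have h1 : (2 : ℝ) ^ (-s) < 1 := Real.rpow_lt_one_of_one_lt_of_neg (by norm_num) (by linarith)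
  have h2 : 0 < 1 - (2 : ℝ) ^ (-s) := by linarith
  refine ⟨2 ^ s * (1 - 2 ^ (-s))⁻¹, by positivity, fun N R hR u hu x => ?_⟩
  obtain ⟨J, hJ⟩ := exists_sum_block_eq hθ N
  rw [hJ u x]
  calc |∑ j ∈ Finset.range (J + 1), block θ j u x|
      ≤ ∑ j ∈ Finset.range (J + 1), |block θ j u x| := Finset.abs_sum_le_sum_abs _ _
    _ ≤ ∑ j ∈ Finset.range (J + 1), R * 2 ^ s * (2 ^ (-s)) ^ j :=
        Finset.sum_le_sum fun j _ => abs_block_le_of_besovHolderNorm_le hR hu j x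
    _ = R * 2 ^ s * ∑ j ∈ Finset.range (J + 1), ((2 : ℝ) ^ (-s)) ^ j := by rw [Finset.mul_sum]
    _ ≤ R * 2 ^ s * (1 - 2 ^ (-s))⁻¹ := by
        gcongr
        rw [← tsum_geometric_of_lt_one h0.le h1]
        exact (summable_geometric_of_lt_one h0.le h1).sum_le_tsum _ fun j _ => by positivity
    _ = _ := by ring

/-- The supremum runs over uncountably many `x`, so measurability goes through lower semicontinuity.
-/
lemma measurable_besovHolderNorm_perp (θ : ℝ → ℝ) (s : ℝ) :
    Measurable fun u : Coeff N => besovHolderNorm θ s (perp u) := by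
  simp_rw [besovHolderNorm, block_perp]
  refine LowerSemicontinuous.measurable (lowerSemicontinuous_iSup fun j =>
    lowerSemicontinuous_iSup fun x => Continuous.lowerSemicontinuous ?_)
  refine ENNReal.continuous_ofReal.comp ?_
  unfold toFun mulCoeff
  fun_prop

@[fun_prop]
lemma continuous_mean : Continuous (mean : Coeff N → ℝ) := continuous_apply _

/-! ### Bounds on the energy -/

lemma energy_eq (γ β : ℝ) (k : ℕ) (u : Coeff N) :
    energy γ β k u = (∑ n : Mode N, ((n : ℤ) : ℝ) ^ 2 * u n ^ 2) / 2
      - γ / β * (∫ x in (0 : ℝ)..2 * Real.pi, Real.cos (β * toFun u x))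
      + max 0 (|mean u| - 2 * Real.pi * k / β) ^ 2 := by
  unfold energy
  rw [deriv_toFun, intervalIntegral.integral_sub
    ((by fun_prop : Continuous _).intervalIntegrable _ _)
    ((by fun_prop : Continuous _).intervalIntegrable _ _), intervalIntegral.integral_div,
    integral_derivFun_sq, intervalIntegral.integral_const_mul]

lemma integral_toFun_sq (u : Coeff N) :
    ∫ x in (0 : ℝ)..2 * Real.pi, toFun u x ^ 2
      = 2 * Real.pi * mean u ^ 2 + ∑ n : Mode N, perp u n ^ 2 := by
  have : ∀ x, toFun u x ^ 2
      = mean u ^ 2 + 2 * mean u * toFun (perp u) x + toFun (perp u) x ^ 2 := fun x => by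
    rw [toFun_eq_mean_add u x]; ring
  simp_rw [this]
  rw [intervalIntegral.integral_add ((by fun_prop : Continuous _).intervalIntegrable _ _)
    ((by fun_prop : Continuous _).intervalIntegrable _ _),
    intervalIntegral.integral_add ((by fun_prop : Continuous _).intervalIntegrable _ _)
    ((by fun_prop : Continuous _).intervalIntegrable _ _),
    intervalIntegral.integral_const_mul, integral_toFun_perp, integral_toFun_perp_sq]
  simp

/-- Precisions of the Gaussian with the weight `c` at the wavenumber `0` and the weights
`(n² + μ) / ε` elsewhere. -/
def precision (c μ ε : ℝ) (n : ℤ) : ℝ := if n = 0 then c else ((n : ℝ) ^ 2 + μ) / ε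

lemma precision_pos {c μ ε : ℝ} (hc : 0 < c) (hμ : -1 < μ) (hε : 0 < ε) (n : ℤ) :
    0 < precision c μ ε n := by
  unfold precision
  split_ifs with h
  · exact hc
  · have : (1 : ℝ) ≤ (n : ℝ) ^ 2 := by
      rw [← sq_abs]; exact one_le_pow₀ (by exact_mod_cast Int.one_le_abs h)
    exact div_pos (by linarith) hε

/-- As `n² ≥ 1`, a shift by at least `-1/2` leaves half of `n²`. One tail bound thus serves both
`wellPrecision` and the weakened precisions `n² - 1/2`. -/
lemma le_precision {c μ ε : ℝ} (hμ : -(1 / 2) ≤ μ) (hε : 0 < ε) (n : ℤ) (hn : n ≠ 0) :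
    (n : ℝ) ^ 2 / (2 * ε) ≤ precision c μ ε n := by
  unfold precision
  rw [if_neg hn, mul_comm 2 ε, ← div_div, div_right_comm]
  have : (1 : ℝ) ≤ (n : ℝ) ^ 2 := by
    rw [← sq_abs]; exact one_le_pow₀ (by exact_mod_cast Int.one_le_abs hn)
  gcongr
  linarith

lemma gaussDensity_precision (c μ ε : ℝ) (u : Coeff N) :
    gaussDensity (precision c μ ε) u = Real.exp (-(c * mean u ^ 2 / 2
      + ((∑ n : Mode N, ((n : ℤ) : ℝ) ^ 2 * u n ^ 2) / 2
        + μ / 2 * ∑ n : Mode N, perp u n ^ 2) / ε)) := by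
  unfold gaussDensity
  congr 2
  have h : ∀ n : Mode N, precision c μ ε n * u n ^ 2 / 2
      = (if n = zeroMode N then c * mean u ^ 2 / 2 else 0)
        + (((n : ℤ) : ℝ) ^ 2 * u n ^ 2 / 2 + μ / 2 * perp u n ^ 2) / ε := by
    intro n
    by_cases hn : n = zeroMode N
    · subst hn; simp [perp, zeroMode, mean, precision]
    · have : (n : ℤ) ≠ 0 := fun h => hn (Subtype.ext h)
      simp only [perp, hn, this, precision, if_false]; ring
  rw [Finset.sum_congr rfl fun n _ => h n, Finset.sum_add_distrib, ← Finset.sum_div,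
    Finset.sum_add_distrib, Finset.sum_div, Finset.mul_sum]
  simp

/-- The generous coefficient of `y⁴` makes the bound global: for `|y| ≥ 1` the right side is already
at least `1`. -/
lemma cos_le_one_sub_add_pow_four (y : ℝ) : Real.cos y ≤ 1 - y ^ 2 / 2 + y ^ 4 / 2 := by
  rcases le_total |y| 1 with h | h
  · have h1 := (abs_le.1 (Real.cos_bound h)).2
    have e : |y| ^ 4 = y ^ 4 := by
      rw [← abs_pow]; exact abs_of_nonneg (by positivity)
    rw [e] at h1
    nlinarith [show 0 ≤ y ^ 4 by positivity]
  · have h1 : 1 ≤ y ^ 2 := by rw [← sq_abs]; exact one_le_pow₀ h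
    nlinarith [Real.cos_le_one y]

/-- The precision at the bottom of the well. -/
abbrev wellPrecision (γ β ε : ℝ) : ℤ → ℝ := precision (2 * Real.pi * γ * β / ε) (γ * β) ε

/-- The factor `2π` in the zero-mode precision is `‖e_0‖²`, so the mass terms of all modes combine
into `∫ u²`. -/
lemma gaussDensity_wellPrecision (γ β ε : ℝ) (u : Coeff N) :
    gaussDensity (wellPrecision γ β ε) u
      = Real.exp (-(((∑ n : Mode N, ((n : ℤ) : ℝ) ^ 2 * u n ^ 2) / 2
        + γ * β / 2 * ∫ x in (0 : ℝ)..2 * Real.pi, toFun u x ^ 2) / ε)) := by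
  rw [gaussDensity_precision, integral_toFun_sq]
  congr 2
  ring

/-- The inequality `cos y ≥ 1 - y²/2` is global, so there is no error term; the bound on the mean
makes the confining term vanish. -/
lemma gaussDensity_le_exp_neg_energy {γ β ε : ℝ} (hγ : 0 < γ) (hβ : 0 < β) (hε : 0 < ε) {k : ℕ}
    {u : Coeff N} (hu : |mean u| ≤ 2 * Real.pi * k / β) :
    Real.exp (2 * Real.pi * γ / (ε * β)) * gaussDensity (wellPrecision γ β ε) u
      ≤ Real.exp (-energy γ β k u / ε) := by
  have hcos : 2 * Real.pi - β ^ 2 / 2 * (∫ x in (0 : ℝ)..2 * Real.pi, toFun u x ^ 2)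
      ≤ ∫ x in (0 : ℝ)..2 * Real.pi, Real.cos (β * toFun u x) := by
    have := intervalIntegral.integral_mono_on (a := 0) (b := 2 * Real.pi) (μ := volume)
      (f := fun x => 1 - β ^ 2 / 2 * toFun u x ^ 2) (g := fun x => Real.cos (β * toFun u x))
      (by positivity) ((by fun_prop : Continuous _).intervalIntegrable _ _)
      ((by fun_prop : Continuous _).intervalIntegrable _ _)
      (fun x _ => le_trans (le_of_eq (by ring)) (Real.one_sub_sq_div_two_le_cos (x := β * toFun u x)))
    rw [intervalIntegral.integral_sub ((by fun_prop : Continuous _).intervalIntegrable _ _)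
      ((by fun_prop : Continuous _).intervalIntegrable _ _),
      intervalIntegral.integral_const_mul] at this
    simpa using this
  rw [gaussDensity_wellPrecision, ← Real.exp_add, energy_eq,
    max_eq_left (by linarith : |mean u| - 2 * Real.pi * k / β ≤ 0)]
  refine Real.exp_le_exp.2 ?_
  have e : 2 * Real.pi * γ / (ε * β) = 2 * Real.pi * (γ / β) / ε := by field_simp
  rw [e, ← sub_eq_add_neg, ← sub_div, div_le_div_iff_of_pos_right hε]
  have h2 := mul_le_mul_of_nonneg_left hcos (div_pos hγ hβ).le
  have e2 : γ / β * (2 * Real.pi - β ^ 2 / 2 * (∫ x in (0 : ℝ)..2 * Real.pi, toFun u x ^ 2))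
      = 2 * Real.pi * (γ / β) - γ * β / 2 * (∫ x in (0 : ℝ)..2 * Real.pi, toFun u x ^ 2) := by
    field_simp
  linarith

lemma exp_neg_energy_le_of_abs_le {γ β ε : ℝ} (hγ : 0 < γ) (hβ : 0 < β) (hε : 0 < ε) (k : ℕ)
    {u : Coeff N} {r : ℝ} (hu : ∀ x, |toFun u x| ≤ r) :
    Real.exp (-energy γ β k u / ε) ≤ Real.exp (2 * Real.pi * γ / (ε * β))
      * Real.exp (Real.pi * γ * β ^ 3 * r ^ 4 / ε) * gaussDensity (wellPrecision γ β ε) u := by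
  have hcos : ∫ x in (0 : ℝ)..2 * Real.pi, Real.cos (β * toFun u x) ≤
      2 * Real.pi - β ^ 2 / 2 * (∫ x in (0 : ℝ)..2 * Real.pi, toFun u x ^ 2)
        + Real.pi * β ^ 4 * r ^ 4 := by
    have := intervalIntegral.integral_mono_on (a := 0) (b := 2 * Real.pi) (μ := volume)
      (g := fun x => (1 + β ^ 4 * r ^ 4 / 2) - β ^ 2 / 2 * toFun u x ^ 2)
      (f := fun x => Real.cos (β * toFun u x))
      (by positivity) ((by fun_prop : Continuous _).intervalIntegrable _ _)
      ((by fun_prop : Continuous _).intervalIntegrable _ _)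
      (fun x _ => by
        refine (cos_le_one_sub_add_pow_four _).trans ?_
        have h4 : toFun u x ^ 4 ≤ r ^ 4 := by
          have := pow_le_pow_left₀ (abs_nonneg _) (hu x) 4
          rwa [← abs_pow, abs_of_nonneg (by positivity)] at this
        have := mul_le_mul_of_nonneg_left h4 (show 0 ≤ β ^ 4 / 2 by positivity)
        rw [mul_pow, mul_pow]
        linarith)
    rw [intervalIntegral.integral_sub ((by fun_prop : Continuous _).intervalIntegrable _ _)
      ((by fun_prop : Continuous _).intervalIntegrable _ _),
      intervalIntegral.integral_const_mul] at this
    refine this.trans (le_of_eq ?_)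
    simp
    ring
  rw [gaussDensity_wellPrecision, ← Real.exp_add, ← Real.exp_add, energy_eq]
  refine Real.exp_le_exp.2 ?_
  have e : 2 * Real.pi * γ / (ε * β) = 2 * Real.pi * (γ / β) / ε := by field_simp
  rw [e, ← sub_eq_add_neg, ← add_div, ← sub_div, div_le_div_iff_of_pos_right hε]
  have h2 := mul_le_mul_of_nonneg_left hcos (div_pos hγ hβ).le
  have e2 : γ / β * (2 * Real.pi - β ^ 2 / 2 * (∫ x in (0 : ℝ)..2 * Real.pi, toFun u x ^ 2)
      + Real.pi * β ^ 4 * r ^ 4)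
      = 2 * Real.pi * (γ / β) - γ * β / 2 * (∫ x in (0 : ℝ)..2 * Real.pi, toFun u x ^ 2)
        + Real.pi * γ * β ^ 3 * r ^ 4 := by
    field_simp
  have h3 : 0 ≤ max 0 (|mean u| - 2 * Real.pi * k / β) ^ 2 := by positivity
  linarith

/-- The coercivity constant of the potential. -/
def coercivity (γ β : ℝ) : ℝ := min (1 / 16) (γ * β / (2 * Real.pi ^ 2))

lemma coercivity_pos {γ β : ℝ} (hγ : 0 < γ) (hβ : 0 < β) : 0 < coercivity γ β := by
  unfold coercivity; positivity

/-- If `|w| ≥ d/2`, the quadratic term gives `d²/16`. Otherwise `|β(m + w)|` stays at distance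
`βd/2` from `0` and `2π`, and Jordan's inequality applied to `1 - cos y = 2 sin² (y/2)` gives
`γβd²/(2π²)`. -/
lemma coercivity_mul_sq_le {γ β : ℝ} (hγ : 0 < γ) (hβ : 0 < β) {d m : ℝ} (hd : 0 ≤ d)
    (h1 : d ≤ |m|) (h2 : |m| ≤ 2 * Real.pi / β - d) (w : ℝ) :
    coercivity γ β * d ^ 2 ≤ w ^ 2 / 4 + γ / β * (1 - Real.cos (β * (m + w))) := by
  have hpi := Real.pi_pos
  have hg : 0 < γ / β := div_pos hγ hβ
  rcases le_total (d / 2) |w| with h | h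
  · have hc : coercivity γ β ≤ 1 / 16 := min_le_left _ _
    have hw : d ^ 2 / 4 ≤ w ^ 2 := by
      rw [← sq_abs w]; nlinarith
    have := mul_nonneg hg.le (sub_nonneg.2 (Real.cos_le_one (β * (m + w))))
    nlinarith [mul_le_mul_of_nonneg_right hc (sq_nonneg d)]
  · have hc : coercivity γ β ≤ γ * β / (2 * Real.pi ^ 2) := min_le_right _ _
    set y := |β * (m + w)| with hy
    have hyβ : y = β * |m + w| := by rw [hy, abs_mul, abs_of_pos hβ]
    have t1 : |m| - |w| ≤ |m + w| := by
      have := abs_sub_abs_le_abs_sub m (-w); rwa [abs_neg, sub_neg_eq_add] at this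
    have t2 := abs_add_le m w
    have y1 : β * d / 2 ≤ y := by
      rw [hyβ]
      have := mul_le_mul_of_nonneg_left (show d / 2 ≤ |m + w| by linarith) hβ.le
      linarith
    have y2 : y ≤ 2 * Real.pi - β * d / 2 := by
      rw [hyβ]
      have := mul_le_mul_of_nonneg_left
        (show |m + w| ≤ 2 * Real.pi / β - d / 2 by linarith) hβ.le
      have e : β * (2 * Real.pi / β - d / 2) = 2 * Real.pi - β * d / 2 := by field_simp
      linarith
    have hbd : β * d / 4 ≤ Real.pi / 2 := by linarith
    have hbd0 : 0 ≤ β * d / 4 := by positivity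
    have hsin : 2 / Real.pi * (β * d / 4) ≤ Real.sin (y / 2) := by
      refine (Real.mul_le_sin hbd0 hbd).trans ?_
      rcases le_total (y / 2) (Real.pi / 2) with hy' | hy'
      · exact Real.sin_le_sin_of_le_of_le_pi_div_two (by linarith) hy' (by linarith)
      · rw [← Real.sin_pi_sub (y / 2)]
        exact Real.sin_le_sin_of_le_of_le_pi_div_two (by linarith) (by linarith) (by linarith)
    have hcos : Real.cos (β * (m + w)) = 1 - 2 * Real.sin (y / 2) ^ 2 := by
      rw [← Real.cos_abs, ← hy]
      have h3 := Real.cos_two_mul (y / 2)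
      have h4 := Real.sin_sq_add_cos_sq (y / 2)
      rw [show 2 * (y / 2) = y by ring] at h3
      linarith
    have hsq := pow_le_pow_left₀ (by positivity) hsin 2
    rw [hcos]
    have e : (2 / Real.pi * (β * d / 4)) ^ 2 = β ^ 2 * d ^ 2 / (4 * Real.pi ^ 2) := by
      field_simp; ring
    rw [e] at hsq
    have h5 := mul_le_mul_of_nonneg_left hsq (show 0 ≤ 2 * (γ / β) by positivity)
    have e2 : 2 * (γ / β) * (β ^ 2 * d ^ 2 / (4 * Real.pi ^ 2))
        = γ * β / (2 * Real.pi ^ 2) * d ^ 2 := by field_simp; ring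
    have h6 := mul_le_mul_of_nonneg_right hc (sq_nonneg d)
    nlinarith [sq_nonneg w]

/-- `coercivity_mul_sq_le` is integrated with `m` the mean and `w` the oscillation. The term `w²/4`
is borrowed from the Dirichlet energy, which produces the shift `-1/2`. The zero-mode weight `c` is
inserted by hand and compensated, so it can be chosen separately on each region. -/
lemma exp_neg_energy_le {γ β ε : ℝ} (hγ : 0 < γ) (hβ : 0 < β) (hε : 0 < ε) (k : ℕ)
    {u : Coeff N} {d : ℝ} (hd : 0 ≤ d) (h1 : d ≤ |mean u|) (h2 : |mean u| ≤ 2 * Real.pi / β - d)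
    (c : ℝ) :
    Real.exp (-energy γ β k u / ε) ≤ Real.exp (2 * Real.pi * γ / (ε * β))
      * Real.exp (c * mean u ^ 2 / 2 - 2 * Real.pi * coercivity γ β * d ^ 2 / ε)
      * gaussDensity (precision c (-(1 / 2)) ε) u := by
  have hint : 2 * Real.pi * (coercivity γ β * d ^ 2) ≤
      (∑ n : Mode N, perp u n ^ 2) / 4 + γ / β * (2 * Real.pi
        - ∫ x in (0 : ℝ)..2 * Real.pi, Real.cos (β * toFun u x)) := by
    have := intervalIntegral.integral_mono_on (a := 0) (b := 2 * Real.pi) (μ := volume)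
      (f := fun _ => coercivity γ β * d ^ 2)
      (g := fun x => toFun (perp u) x ^ 2 / 4 + γ / β * (1 - Real.cos (β * toFun u x)))
      (by positivity) ((by fun_prop : Continuous _).intervalIntegrable _ _)
      ((by fun_prop : Continuous _).intervalIntegrable _ _)
      (fun x _ => by
        rw [toFun_eq_mean_add u x]
        exact coercivity_mul_sq_le hγ hβ hd h1 h2 _)
    rw [intervalIntegral.integral_add ((by fun_prop : Continuous _).intervalIntegrable _ _)
      ((by fun_prop : Continuous _).intervalIntegrable _ _),
      intervalIntegral.integral_const_mul (γ / β),
      intervalIntegral.integral_sub ((by fun_prop : Continuous _).intervalIntegrable _ _)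
      ((by fun_prop : Continuous _).intervalIntegrable _ _),
      intervalIntegral.integral_div, integral_toFun_perp_sq] at this
    rw [mul_left_comm (2 * Real.pi)]
    simpa using this
  rw [gaussDensity_precision, ← Real.exp_add, ← Real.exp_add, energy_eq]
  refine Real.exp_le_exp.2 ?_
  have e : 2 * Real.pi * γ / (ε * β) = 2 * Real.pi * (γ / β) / ε := by field_simp
  rw [e]
  have h3 : 0 ≤ max 0 (|mean u| - 2 * Real.pi * k / β) ^ 2 := by positivity
  set T := max 0 (|mean u| - 2 * Real.pi * k / β) ^ 2
  set I := ∫ x in (0 : ℝ)..2 * Real.pi, Real.cos (β * toFun u x)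
  set S := ∑ n : Mode N, ((n : ℤ) : ℝ) ^ 2 * u n ^ 2
  set S' := ∑ n : Mode N, perp u n ^ 2
  have h4 : -(S / 2 - γ / β * I + T) / ε ≤ (2 * Real.pi * (γ / β)
      - 2 * Real.pi * coercivity γ β * d ^ 2 - (S / 2 + -(1 / 2) / 2 * S')) / ε := by
    gcongr
    linarith
  refine h4.trans (le_of_eq ?_)
  ring

/-! ### Comparison of Gaussian normalizations -/

lemma gaussMass_eq (N : ℕ) (a : ℤ → ℝ) : gaussMass N a = √(2 * Real.pi / a 0)
    * ∏ n ∈ (Finset.Icc (-(N : ℤ)) (N : ℤ)).erase 0, √(2 * Real.pi / a n) := by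
  rw [Finset.mul_prod_erase _ (fun n => √(2 * Real.pi / a n)) (by simp)]
  exact Finset.prod_coe_sort (Finset.Icc (-(N : ℤ)) (N : ℤ)) fun n => √(2 * Real.pi / a n)

lemma wellMass_eq {γ β ε : ℝ} (hγ : 0 < γ) (hβ : 0 < β) (hε : 0 < ε) (N : ℕ) :
    wellMass N γ β ε
      = gaussMass N (wellPrecision γ β ε) * Real.exp (2 * Real.pi * γ / (ε * β)) := by
  rw [wellMass, gaussMass_eq]
  congr 1
  rw [Real.sqrt_mul (by positivity), Real.sqrt_prod _ fun n _ => by positivity]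
  congr 1
  · simp only [precision, if_true]
    congr 1
    field_simp
  · refine Finset.prod_congr rfl fun n hn => ?_
    simp only [precision, Finset.ne_of_mem_erase hn, if_false]
    congr 1
    field_simp

/-- The ratio of the factors at `n ≠ 0` is `√((n² + γβ)/(n² - 1/2)) ≤ exp (b/n²)`, so the product is
bounded uniformly in `N` by a convergent series. -/
lemma exists_gaussMass_le {γ β : ℝ} (hγ : 0 < γ) (hβ : 0 < β) :
    ∃ K : ℝ, 0 < K ∧ ∀ (N : ℕ) (c ε : ℝ), 0 < c → 0 < ε →
      gaussMass N (precision c (-(1 / 2)) ε)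
        ≤ K * (√(2 * Real.pi / c) / √(ε / (γ * β))) * gaussMass N (wellPrecision γ β ε) := by
  set b := γ * β + 1 / 2 with hb
  have hb0 : 0 < b := by positivity
  -- The term at `n = 0` is `0`, by the convention `1 / 0 = 0`.
  refine ⟨Real.exp (∑' n : ℤ, b * (1 / (n : ℝ) ^ 2)), Real.exp_pos _, fun N c ε hc hε => ?_⟩
  have hsum : Summable fun n : ℤ => b * (1 / (n : ℝ) ^ 2) :=
    (Real.summable_one_div_int_pow.2 one_lt_two).mul_left b
  rw [gaussMass_eq, gaussMass_eq]
  set S := (Finset.Icc (-(N : ℤ)) (N : ℤ)).erase 0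
  have hterm : ∀ n ∈ S, √(2 * Real.pi / precision c (-(1 / 2)) ε n)
      ≤ Real.exp (b * (1 / (n : ℝ) ^ 2)) * √(2 * Real.pi / wellPrecision γ β ε n) := by
    intro n hn
    have hn0 := Finset.ne_of_mem_erase hn
    have hn1 : (1 : ℝ) ≤ (n : ℝ) ^ 2 := by
      rw [← sq_abs]; exact one_le_pow₀ (by exact_mod_cast Int.one_le_abs hn0)
    have hE := Real.add_one_le_exp (2 * (b * (1 / (n : ℝ) ^ 2)))
    rw [show Real.exp (2 * (b * (1 / (n : ℝ) ^ 2))) = Real.exp (b * (1 / (n : ℝ) ^ 2)) ^ 2 by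
      rw [sq (Real.exp _), ← Real.exp_add]; ring_nf] at hE
    rw [← Real.sqrt_sq (Real.exp_pos (b * (1 / (n : ℝ) ^ 2))).le, ← Real.sqrt_mul (sq_nonneg _)]
    refine Real.sqrt_le_sqrt ?_
    refine le_trans ?_ (mul_le_mul_of_nonneg_right hE (by
      have := precision_pos (c := 2 * Real.pi * γ * β / ε) (μ := γ * β) (by positivity)
        (by nlinarith [mul_pos hγ hβ]) hε n
      positivity))
    simp only [precision, hn0, if_false]
    have h1 : 0 < (n : ℝ) ^ 2 + -(1 / 2) := by linarith
    have h2 : 0 < (n : ℝ) ^ 2 + γ * β := by positivity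
    rw [div_div_eq_mul_div, div_div_eq_mul_div, mul_div_assoc', div_le_div_iff₀ h1 h2]
    have h3 : (n : ℝ) ^ 2 + γ * β ≤ (2 * (b * (1 / (n : ℝ) ^ 2)) + 1) * ((n : ℝ) ^ 2 + -(1 / 2)) := by
      have e : (2 * (b * (1 / (n : ℝ) ^ 2)) + 1) * ((n : ℝ) ^ 2 + -(1 / 2))
        = (n : ℝ) ^ 2 - 1 / 2 + b * (2 - 1 / (n : ℝ) ^ 2) := by
          field_simp; ring
      rw [e]
      have : 1 / (n : ℝ) ^ 2 ≤ 1 := by rw [div_le_one (by linarith)]; exact hn1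
      nlinarith
    nlinarith [mul_le_mul_of_nonneg_left h3 (show 0 ≤ 2 * Real.pi * ε by positivity)]
  have hprod : ∏ n ∈ S, √(2 * Real.pi / precision c (-(1 / 2)) ε n)
      ≤ Real.exp (∑' n : ℤ, b * (1 / (n : ℝ) ^ 2))
        * ∏ n ∈ S, √(2 * Real.pi / wellPrecision γ β ε n) := by
    refine (Finset.prod_le_prod (fun n _ => Real.sqrt_nonneg _) hterm).trans ?_
    rw [Finset.prod_mul_distrib, ← Real.exp_sum]
    gcongr
    exact hsum.sum_le_tsum _ fun n _ => by positivity
  have e0 : 2 * Real.pi / wellPrecision γ β ε 0 = ε / (γ * β) := by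
    simp only [precision, if_true]; field_simp
  have hs : √(ε / (γ * β)) ≠ 0 := by positivity
  rw [e0, show precision c (-(1 / 2)) ε 0 = c by simp [precision]]
  refine (mul_le_mul_of_nonneg_left hprod (Real.sqrt_nonneg _)).trans (le_of_eq ?_)
  field_simp

/-- Gaussian tail of the mean. -/
lemma lintegral_abs_mean_ge_le {a : ℤ → ℝ} (ha : ∀ n, 0 < a n) {δ : ℝ} (hδ : 0 ≤ δ) :
    ∫⁻ u in {u : Coeff N | δ ≤ |mean u|}, ENNReal.ofReal (gaussDensity a u)
      ≤ ENNReal.ofReal (2 * Real.exp (-(a 0 * δ ^ 2 / 2)) * gaussMass N a) := by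
  have hZ := gaussMass_pos (N := N) ha
  have ha0 := ha 0
  -- The optimal Chernoff parameter for a centred Gaussian of variance `1 / a 0`.
  set l := a 0 * δ with hl
  have hl0 : 0 ≤ l := by positivity
  have hF : ∀ l' : ℝ, l' ^ 2 = l ^ 2 → ∫⁻ u : Coeff N,
      ENNReal.ofReal (Real.exp (l' * mean u) * gaussDensity a u)
      ≤ ENNReal.ofReal (gaussMass N a * Real.exp (l ^ 2 / (2 * a 0))) := by
    intro l' h'
    have h := lintegral_exp_linear_mul_gaussDensity (N := N) ha (Pi.single (zeroMode N) l')
    have e1 : ∀ u : Coeff N, ∑ n, (Pi.single (zeroMode N) l' : Mode N → ℝ) n * u n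
        = l' * mean u := by
      intro u
      rw [Finset.sum_eq_single (zeroMode N) (fun b _ hb => by simp [hb]) (by simp)]
      simp [mean]
    have e2 : ∑ n, (Pi.single (zeroMode N) l' : Mode N → ℝ) n ^ 2 / (2 * a n)
        = l ^ 2 / (2 * a 0) := by
      rw [Finset.sum_eq_single (zeroMode N) (fun b _ hb => by simp [hb]) (by simp)]
      simp [h', zeroMode]
    simp_rw [e1, e2] at h
    exact h.le
  have hmeas : ∀ l' : ℝ, Measurable fun u : Coeff N =>
      ENNReal.ofReal (Real.exp (l' * mean u) * gaussDensity a u) := fun l' =>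
    ENNReal.continuous_ofReal.measurable.comp (by fun_prop : Continuous _).measurable
  have hmeas2 : Measurable fun u : Coeff N =>
      ENNReal.ofReal (Real.exp (l * mean u) * gaussDensity a u)
        + ENNReal.ofReal (Real.exp (-l * mean u) * gaussDensity a u) := (hmeas l).add (hmeas (-l))
  calc ∫⁻ u in {u : Coeff N | δ ≤ |mean u|}, ENNReal.ofReal (gaussDensity a u)
      ≤ ∫⁻ u in {u : Coeff N | δ ≤ |mean u|}, ENNReal.ofReal (Real.exp (-(l * δ))) *
          (ENNReal.ofReal (Real.exp (l * mean u) * gaussDensity a u)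
            + ENNReal.ofReal (Real.exp (-l * mean u) * gaussDensity a u)) := by
        refine setLIntegral_mono (hmeas2.const_mul _) fun u hu => ?_
        have hg := gaussDensity_pos a u
        rw [← ENNReal.ofReal_add (by positivity) (by positivity),
          ← ENNReal.ofReal_mul (by positivity), ← add_mul, ← mul_assoc, mul_add, ← Real.exp_add,
          ← Real.exp_add]
        refine ENNReal.ofReal_le_ofReal (le_mul_of_one_le_left hg.le ?_)
        have p1 := Real.exp_pos (-(l * δ) + l * mean u)
        have p2 := Real.exp_pos (-(l * δ) + -l * mean u)
        rcases le_abs.1 (show δ ≤ |mean u| from hu) with h | h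
        · have := Real.one_le_exp (x := -(l * δ) + l * mean u) (by nlinarith)
          linarith
        · have := Real.one_le_exp (x := -(l * δ) + -l * mean u) (by nlinarith)
          linarith
    _ ≤ ∫⁻ u : Coeff N, ENNReal.ofReal (Real.exp (-(l * δ))) *
          (ENNReal.ofReal (Real.exp (l * mean u) * gaussDensity a u)
            + ENNReal.ofReal (Real.exp (-l * mean u) * gaussDensity a u)) :=
        lintegral_mono' Measure.restrict_le_self le_rfl
    _ ≤ ENNReal.ofReal (Real.exp (-(l * δ))
          * (2 * (gaussMass N a * Real.exp (l ^ 2 / (2 * a 0))))) :=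
        lintegral_const_mul_add_le (hmeas l) (hmeas (-l)) (Real.exp_pos _).le (by positivity)
          (hF l rfl) (hF (-l) (neg_sq l))
    _ = _ := by
        congr 1
        have : Real.exp (-(a 0 * δ ^ 2 / 2))
            = Real.exp (-(l * δ)) * Real.exp (l ^ 2 / (2 * a 0)) := by
          rw [← Real.exp_add]; congr 1; rw [hl]; field_simp; ring
        rw [this]; ring

/-! ### The equilibrium potential on the initial set -/

/-- Starting in `B` gives `τ_B = 0`, while continuity keeps the path in `U`, hence off `A`, for a
positive time. The separate open set `U` avoids any topological property of `B`. -/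
lemma equilibriumPotential_eq_one {Ω : Type*} [MeasurableSpace Ω] {γ β ε : ℝ} {k : ℕ}
    {P : Measure Ω} [IsProbabilityMeasure P] {W : Mode N → ℝ≥0 → Ω → ℝ}
    {X : Coeff N → ℝ≥0 → Ω → Coeff N} (hW : IsNoise P W) {z : Coeff N}
    (hX : IsSolution γ β ε k P W z (X z)) {A B U : Set (Coeff N)} (hU : IsOpen U) (hzU : z ∈ U)
    (hUA : Disjoint U A) (hzB : z ∈ B) :
    equilibriumPotential P X B A z = 1 := by
  have hW0 : ∀ᵐ ω ∂P, ∀ n, W n 0 ω = 0 :=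
    ae_all_iff.2 fun n => (hW.brownian n).toIsPreBrownianReal.eval_zero_ae_eq_zero
  have hae : ∀ᵐ ω ∂P, hittingAfter (X z) B 0 ω < hittingAfter (X z) A 0 ω := by
    filter_upwards [hX.continuous, hX.integral_eq, hW0] with ω hc hi h0
    have hX0 : X z 0 ω = z := by
      ext n
      rw [hi 0 n, h0 n]
      simp
    have hB : hittingAfter (X z) B 0 ω ≤ (0 : ℝ≥0) :=
      hittingAfter_le_of_mem le_rfl (by rw [hX0]; exact hzB)
    obtain ⟨t, ht, htU⟩ : ∃ t : ℝ≥0, 0 < t ∧ ∀ s < t, X z s ω ∈ U := by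
      have hnhds : ∀ᶠ s in nhds (0 : ℝ≥0), X z s ω ∈ U :=
        hc.continuousAt.eventually (hU.mem_nhds (by simpa only [hX0] using hzU))
      rw [← bot_eq_zero', (nhds_bot_basis (α := ℝ≥0)).eventually_iff] at hnhds
      obtain ⟨t, ht, h⟩ := hnhds
      exact ⟨t, ht, fun s hs => h hs⟩
    refine hB.trans_lt (lt_of_lt_of_le (WithTop.coe_lt_coe.2 ht) ?_)
    rw [hittingAfter_def]
    dsimp only
    split_ifs with h
    · refine WithTop.coe_le_coe.2 (le_csInf h fun s hs => ?_)
      by_contra hlt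
      exact Set.disjoint_left.1 hUA (htU s (not_le.1 hlt)) hs.2
    · exact le_top
  exact (measure_congr (Filter.eventuallyEq_univ.2 hae)).trans measure_univ

/-! ### The mass of the well -/

lemma exp_neg_log_one_div {ε : ℝ} (hε : 0 < ε) : Real.exp (-Real.log (1 / ε)) = ε := by
  rw [one_div, Real.log_inv, neg_neg, Real.exp_log hε]

/-- With `L = log (1/ε)`, `L⁵/5! ≤ exp L = 1/ε` gives `ε L⁴ ≤ 120/L`, and the choice of `ε₀` forces
`L > 1 + 120 M`. -/
lemma exists_small (M : ℝ) (hM : 0 < M) : ∃ ε₀ : ℝ, 0 < ε₀ ∧ ∀ ε : ℝ, 0 < ε → ε < ε₀ →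
    1 ≤ Real.log (1 / ε) ∧ M * (ε * Real.log (1 / ε) ^ 4) ≤ 1 := by
  refine ⟨Real.exp (-(1 + 120 * M)), Real.exp_pos _, fun ε hε h => ?_⟩
  have hexp := exp_neg_log_one_div hε
  set L := Real.log (1 / ε) with hL
  have h1 : 1 + 120 * M < L := by
    rw [← hexp, Real.exp_lt_exp] at h
    linarith
  have h0 : 0 < L := by linarith
  refine ⟨by linarith, ?_⟩
  have h2 : L ^ 5 / 120 ≤ Real.exp L := by
    have := Real.pow_div_factorial_le_exp L h0.le 5
    simpa [Nat.factorial] using this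
  have h3 : ε * (L ^ 5 / 120) ≤ 1 := by
    have := mul_le_mul_of_nonneg_left h2 hε.le
    have e : ε * Real.exp L = 1 := by
      nth_rw 1 [← hexp]
      rw [← Real.exp_add, neg_add_cancel, Real.exp_zero]
    linarith
  have h4 : 0 < ε * L ^ 4 := by positivity
  calc M * (ε * L ^ 4) ≤ L / 120 * (ε * L ^ 4) := by gcongr; linarith
    _ = ε * (L ^ 5 / 120) := by ring
    _ ≤ 1 := h3

/-- The maximum of the quadratic over `L`. It shows that `exp (-p L²)` beats any power of `ε = exp
(-L)` with an explicit constant. -/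
lemma exp_quadratic_le {p : ℝ} (hp : 0 < p) (q L : ℝ) :
    Real.exp (q * L - p * L ^ 2) ≤ Real.exp (q ^ 2 / (4 * p)) := by
  refine Real.exp_le_exp.2 ?_
  rw [le_div_iff₀ (by positivity)]
  nlinarith [sq_nonneg (2 * p * L - q)]

lemma setLIntegral_ofReal_le_mul {a : ℤ → ℝ} {S : Set (Coeff N)} {f : Coeff N → ℝ} {c : ℝ}
    (hc : 0 ≤ c) (h : ∀ u ∈ S, f u ≤ c * gaussDensity a u) :
    ∫⁻ u in S, ENNReal.ofReal (f u)
      ≤ ENNReal.ofReal c * ∫⁻ u in S, ENNReal.ofReal (gaussDensity a u) := by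
  have hm : Measurable fun u : Coeff N => ENNReal.ofReal (gaussDensity a u) :=
    ENNReal.continuous_ofReal.measurable.comp (continuous_gaussDensity a).measurable
  rw [← lintegral_const_mul _ hm]
  refine setLIntegral_mono (hm.const_mul _) fun u hu => ?_
  rw [← ENNReal.ofReal_mul hc]
  exact ENNReal.ofReal_le_ofReal (h u hu)

lemma wellPrecision_pos {γ β ε : ℝ} (hγ : 0 < γ) (hβ : 0 < β) (hε : 0 < ε) (n : ℤ) :
    0 < wellPrecision γ β ε n :=
  precision_pos (by positivity) (by nlinarith [mul_pos hγ hβ]) hε n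

lemma wellMass_pos {γ β ε : ℝ} (hγ : 0 < γ) (hβ : 0 < β) (hε : 0 < ε) (N : ℕ) :
    0 < wellMass N γ β ε := by
  rw [wellMass_eq hγ hβ hε]
  exact mul_pos (gaussMass_pos (wellPrecision_pos hγ hβ hε)) (Real.exp_pos _)

lemma measurableSet_initialSet (θ : ℝ → ℝ) (κ c₀ ε : ℝ) :
    MeasurableSet (initialSet N θ κ c₀ ε) :=
  (measurableSet_lt continuous_mean.abs.measurable measurable_const).inter
    (measurableSet_lt (measurable_besovHolderNorm_perp θ _) measurable_const)

/-- The Gaussian approximation gives almost full mass to the initial set. -/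
lemma le_lintegral_initialSet {γ β : ℝ} (hγ : 0 < γ) (hβ : 0 < β) {θ : ℝ → ℝ} {κ c₀ ε K : ℝ}
    (hε : 0 < ε) (hL : 1 ≤ Real.log (1 / ε)) (hK : 0 < K)
    (htail : ∫⁻ u in {u : Coeff N | ENNReal.ofReal (√(c₀ * ε * Real.log (1 / ε)))
          ≤ besovHolderNorm θ (1 / 2 - κ) (perp u)},
            ENNReal.ofReal (gaussDensity (wellPrecision γ β ε) u)
        ≤ ENNReal.ofReal (K * ε * gaussMass N (wellPrecision γ β ε))) :
    ENNReal.ofReal (gaussMass N (wellPrecision γ β ε)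
        * (1 - (2 * Real.exp (1 / (4 * (Real.pi * γ * β))) + K) * ε))
      ≤ ∫⁻ u in initialSet N θ κ c₀ ε, ENNReal.ofReal (gaussDensity (wellPrecision γ β ε) u) := by
  have ha := wellPrecision_pos hγ hβ hε
  have hZ := gaussMass_pos (N := N) ha
  set a := wellPrecision γ β ε
  set L := Real.log (1 / ε)
  have hmean : ∫⁻ u in {u : Coeff N | √ε * L ≤ |mean u|}, ENNReal.ofReal (gaussDensity a u)
      ≤ ENNReal.ofReal (2 * Real.exp (1 / (4 * (Real.pi * γ * β))) * ε * gaussMass N a) := by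
    refine (lintegral_abs_mean_ge_le ha (by positivity)).trans (ENNReal.ofReal_le_ofReal ?_)
    have e : Real.exp (-(a 0 * (√ε * L) ^ 2 / 2))
        = Real.exp (1 * L - Real.pi * γ * β * L ^ 2) * Real.exp (-L) := by
      rw [← Real.exp_add, mul_pow, Real.sq_sqrt hε.le]
      congr 1
      simp only [a, precision, if_true, L]
      field_simp
      ring
    rw [e, exp_neg_log_one_div hε, ← mul_assoc]
    have := exp_quadratic_le (show 0 < Real.pi * γ * β by positivity) 1 L
    rw [one_pow] at this
    gcongr
  have hcover : (Set.univ : Set (Coeff N)) ⊆ initialSet N θ κ c₀ ε ∪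
      ({u | √ε * L ≤ |mean u|} ∪ {u : Coeff N | ENNReal.ofReal (√(c₀ * ε * L))
          ≤ besovHolderNorm θ (1 / 2 - κ) (perp u)}) := by
    intro u _
    by_cases h1 : √ε * L ≤ |mean u|
    · exact Or.inr (Or.inl h1)
    by_cases h2 : ENNReal.ofReal (√(c₀ * ε * L)) ≤ besovHolderNorm θ (1 / 2 - κ) (perp u)
    · exact Or.inr (Or.inr h2)
    exact Or.inl ⟨not_le.1 h1, not_le.1 h2⟩
  have htot : ENNReal.ofReal (gaussMass N a)
      ≤ (∫⁻ u in initialSet N θ κ c₀ ε, ENNReal.ofReal (gaussDensity a u))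
        + (ENNReal.ofReal (2 * Real.exp (1 / (4 * (Real.pi * γ * β))) * ε * gaussMass N a)
          + ENNReal.ofReal (K * ε * gaussMass N a)) := by
    rw [← lintegral_gaussDensity ha, ← setLIntegral_univ]
    refine (lintegral_mono_set hcover).trans ((lintegral_union_le _ _ _).trans ?_)
    gcongr
    exact (lintegral_union_le _ _ _).trans (add_le_add hmean htail)
  rw [← ENNReal.ofReal_add (by positivity) (by positivity)] at htot
  have e : gaussMass N a * (1 - (2 * Real.exp (1 / (4 * (Real.pi * γ * β))) + K) * ε)
      = gaussMass N a - (2 * Real.exp (1 / (4 * (Real.pi * γ * β))) * ε * gaussMass N a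
        + K * ε * gaussMass N a) := by ring
  rw [e, ENNReal.ofReal_sub _ (by positivity)]
  exact tsub_le_iff_right.2 htot

/-- Since `√L ≤ L`, the sup norm on this set is at most `r = (1 + G√c₀) √ε L`. The quartic error
`r⁴/ε` is then of order `ε L⁴`, and `exp x ≤ 1 + 2x` on `[0, 1]` linearizes it. -/
lemma lintegral_initialSet_le {γ β : ℝ} (hγ : 0 < γ) (hβ : 0 < β) (k : ℕ) {θ : ℝ → ℝ}
    {κ c₀ ε G : ℝ} (hc₀ : 0 ≤ c₀) (hε : 0 < ε) (hL : 1 ≤ Real.log (1 / ε)) (hG : 0 < G)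
    (hsup : ∀ R : ℝ, 0 ≤ R → ∀ u : Coeff N,
      besovHolderNorm θ (1 / 2 - κ) u ≤ ENNReal.ofReal R → ∀ x, |toFun u x| ≤ G * R)
    (hsmall : Real.pi * γ * β ^ 3 * (1 + G * √c₀) ^ 4 * (ε * Real.log (1 / ε) ^ 4) ≤ 1) :
    ∫⁻ u in initialSet N θ κ c₀ ε, ENNReal.ofReal (Real.exp (-energy γ β k u / ε))
      ≤ ENNReal.ofReal (wellMass N γ β ε * (1 + 2 * (Real.pi * γ * β ^ 3 * (1 + G * √c₀) ^ 4)
          * (ε * Real.log (1 / ε) ^ 4))) := by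
  have ha := wellPrecision_pos hγ hβ hε
  have hZ := gaussMass_pos (N := N) ha
  set a := wellPrecision γ β ε with hadef
  set L := Real.log (1 / ε)
  have hL0 : 0 < L := by linarith
  set r := (1 + G * √c₀) * (√ε * L) with hr
  have hr4 : r ^ 4 = (1 + G * √c₀) ^ 4 * (ε ^ 2 * L ^ 4) := by
    rw [hr, mul_pow, mul_pow, show √ε ^ 4 = (√ε ^ 2) ^ 2 by ring, Real.sq_sqrt hε.le]
  have hB : ∀ u ∈ initialSet N θ κ c₀ ε, ∀ x, |toFun u x| ≤ r := by
    rintro u ⟨h1, h2⟩ x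
    rw [toFun_eq_mean_add u x]
    refine (abs_add_le _ _).trans ?_
    have h3 := hsup _ (Real.sqrt_nonneg _) _ h2.le x
    have h4 : √(c₀ * ε * L) ≤ √c₀ * (√ε * L) := by
      rw [Real.sqrt_mul (by positivity), Real.sqrt_mul hc₀, mul_assoc]
      gcongr
      exact (Real.sqrt_le_left hL0.le).2 (by nlinarith)
    have h5 := mul_le_mul_of_nonneg_left h4 hG.le
    have h6 : |mean u| ≤ √ε * L := h1.le
    rw [hr]
    linarith
  set x := Real.pi * γ * β ^ 3 * (1 + G * √c₀) ^ 4 * (ε * L ^ 4) with hx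
  have hx0 : 0 ≤ x := by positivity
  have hexpx : Real.exp x ≤ 1 + 2 * x := by
    have := Real.abs_exp_sub_one_le (x := x) (by rw [abs_of_nonneg hx0]; exact hsmall)
    rw [abs_of_nonneg hx0] at this
    linarith [le_abs_self (Real.exp x - 1)]
  have e : Real.pi * γ * β ^ 3 * r ^ 4 / ε = x := by
    rw [hr4, hx]; field_simp
  refine (setLIntegral_ofReal_le_mul (a := a)
    (c := Real.exp (2 * Real.pi * γ / (ε * β)) * Real.exp x) (by positivity) fun u hu => ?_).trans ?_
  · rw [← e]
    exact exp_neg_energy_le_of_abs_le hγ hβ hε k (hB u hu)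
  · refine (mul_le_mul_right (lintegral_mono' Measure.restrict_le_self le_rfl) _).trans ?_
    rw [lintegral_gaussDensity ha, ← ENNReal.ofReal_mul (by positivity), wellMass_eq hγ hβ hε,
      ← hadef]
    refine ENNReal.ofReal_le_ofReal ?_
    calc Real.exp (2 * Real.pi * γ / (ε * β)) * Real.exp x * gaussMass N a
        ≤ Real.exp (2 * Real.pi * γ / (ε * β)) * (1 + 2 * x) * gaussMass N a := by gcongr
      _ = _ := by rw [hx]; ring

lemma lintegral_rough_le {γ β : ℝ} (hγ : 0 < γ) (hβ : 0 < β) (k : ℕ) {θ : ℝ → ℝ}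
    {κ c₀ ε K Kz : ℝ} (hε : 0 < ε) (hK : 0 < K)
    (hδ : √ε * Real.log (1 / ε) ≤ Real.pi / (2 * β))
    (htail : ∀ a : ℤ → ℝ, (∀ n, 0 < a n) → (∀ n : ℤ, n ≠ 0 → (n : ℝ) ^ 2 / (2 * ε) ≤ a n) →
      ∫⁻ u in {u : Coeff N | ENNReal.ofReal (√(c₀ * ε * Real.log (1 / ε)))
          ≤ besovHolderNorm θ (1 / 2 - κ) (perp u)}, ENNReal.ofReal (gaussDensity a u)
        ≤ ENNReal.ofReal (K * ε * gaussMass N a))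
    (hmass : ∀ c : ℝ, 0 < c → gaussMass N (precision c (-(1 / 2)) ε)
        ≤ Kz * (√(2 * Real.pi / c) / √(ε / (γ * β))) * gaussMass N (wellPrecision γ β ε)) :
    ∫⁻ u in {u : Coeff N | |mean u| < √ε * Real.log (1 / ε)} ∩
          {u | ENNReal.ofReal (√(c₀ * ε * Real.log (1 / ε)))
            ≤ besovHolderNorm θ (1 / 2 - κ) (perp u)},
        ENNReal.ofReal (Real.exp (-energy γ β k u / ε))
      ≤ ENNReal.ofReal (wellMass N γ β ε
          * (K * Kz * √(γ * β / (2 * coercivity γ β)) * ε)) := by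
  have hco := coercivity_pos hγ hβ
  -- Coercivity is used with `d = |mean u|`; this `c` makes the zero-mode Gaussian equal to the
  -- coercive decay. It has the same order `1/ε` as the true precision, so the ratio of
  -- normalizations does not depend on `ε`.
  set c := 4 * Real.pi * coercivity γ β / ε with hc
  have hc0 : 0 < c := by positivity
  have ha : ∀ n, 0 < precision c (-(1 / 2)) ε n := precision_pos hc0 (by norm_num) hε
  have ha2 := le_precision (c := c) (μ := -(1 / 2)) le_rfl hε
  refine (setLIntegral_ofReal_le_mul (a := precision c (-(1 / 2)) ε)
    (c := Real.exp (2 * Real.pi * γ / (ε * β))) (by positivity) fun u hu => ?_).trans ?_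
  · have hu1 : |mean u| < √ε * Real.log (1 / ε) := hu.1
    have h2 : |mean u| ≤ 2 * Real.pi / β - |mean u| := by
      have e : 2 * Real.pi / β = 4 * (Real.pi / (2 * β)) := by field_simp; norm_num
      have : 0 < Real.pi / (2 * β) := by positivity
      rw [e]; linarith
    refine (exp_neg_energy_le hγ hβ hε k (abs_nonneg _) le_rfl h2 c).trans (le_of_eq ?_)
    have : c * mean u ^ 2 / 2 - 2 * Real.pi * coercivity γ β * |mean u| ^ 2 / ε = 0 := by
      rw [sq_abs, hc]; field_simp; ring
    rw [this, Real.exp_zero, mul_one]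
  · refine (mul_le_mul_right ((lintegral_mono_set Set.inter_subset_right).trans
      (htail _ ha ha2)) _).trans ?_
    rw [← ENNReal.ofReal_mul (by positivity), wellMass_eq hγ hβ hε]
    refine ENNReal.ofReal_le_ofReal ?_
    have e : √(2 * Real.pi / c) / √(ε / (γ * β)) = √(γ * β / (2 * coercivity γ β)) := by
      rw [← Real.sqrt_div (by positivity)]
      congr 1
      rw [hc]; field_simp; norm_num
    have h := hmass c hc0
    rw [e] at h
    calc Real.exp (2 * Real.pi * γ / (ε * β)) * (K * ε * gaussMass N (precision c (-(1 / 2)) ε))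
        ≤ Real.exp (2 * Real.pi * γ / (ε * β)) * (K * ε *
          (Kz * √(γ * β / (2 * coercivity γ β)) * gaussMass N (wellPrecision γ β ε))) := by gcongr
      _ = _ := by ring

lemma lintegral_between_wells_le {γ β : ℝ} (hγ : 0 < γ) (hβ : 0 < β) (k : ℕ) {ε Kz : ℝ}
    (hε : 0 < ε) (hL : 1 ≤ Real.log (1 / ε)) (hKz : 0 < Kz)
    (hmass : ∀ c : ℝ, 0 < c → gaussMass N (precision c (-(1 / 2)) ε)
        ≤ Kz * (√(2 * Real.pi / c) / √(ε / (γ * β))) * gaussMass N (wellPrecision γ β ε)) :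
    ∫⁻ u in {u : Coeff N | √ε * Real.log (1 / ε) ≤ |mean u| ∧
          |mean u| ≤ 2 * Real.pi / β - √ε * Real.log (1 / ε)},
        ENNReal.ofReal (Real.exp (-energy γ β k u / ε))
      ≤ ENNReal.ofReal (wellMass N γ β ε
          * (Real.exp 1 * Real.exp ((3 / 2) ^ 2 / (4 * (2 * Real.pi * coercivity γ β)))
            * Kz * √(4 * Real.pi ^ 3 * γ / β) * ε)) := by
  have hco := coercivity_pos hγ hβ
  set L := Real.log (1 / ε) with hLdef
  -- The mean is bounded by `2π/β` here, so a weight of order one suffices to integrate over it: it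
  -- costs a factor `exp 1` and a normalization ratio of order `ε^(-1/2) = exp (L/2)`. Coercivity
  -- with `d = √ε L` supplies `exp (-p L²)`, which absorbs this and leaves a factor `ε`.
  set c := β ^ 2 / (2 * Real.pi ^ 2) with hc
  have hc0 : 0 < c := by positivity
  have ha : ∀ n, 0 < precision c (-(1 / 2)) ε n := precision_pos hc0 (by norm_num) hε
  set p := 2 * Real.pi * coercivity γ β with hp
  have hp0 : 0 < p := by positivity
  refine (setLIntegral_ofReal_le_mul (a := precision c (-(1 / 2)) ε)
    (c := Real.exp (2 * Real.pi * γ / (ε * β)) * (Real.exp 1 * Real.exp (-(p * L ^ 2))))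
    (by positivity) fun u hu => ?_).trans ?_
  · obtain ⟨h1, h2⟩ := hu
    have hδ0 : 0 ≤ √ε * L := by positivity
    refine (exp_neg_energy_le hγ hβ hε k hδ0 h1 h2 c).trans ?_
    rw [← Real.exp_add 1]
    have hg := (gaussDensity_pos (precision c (-(1 / 2)) ε) u).le
    gcongr ?_ * ?_ * ?_
    refine Real.exp_le_exp.2 ?_
    have e1 : 2 * Real.pi * coercivity γ β * (√ε * L) ^ 2 / ε = p * L ^ 2 := by
      rw [mul_pow, Real.sq_sqrt hε.le, hp]; field_simp
    have e2 : c * mean u ^ 2 / 2 ≤ 1 := by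
      have h3 : mean u ^ 2 ≤ (2 * Real.pi / β) ^ 2 := by
        rw [← sq_abs]; exact pow_le_pow_left₀ (abs_nonneg _) (by linarith) 2
      have h4 := mul_le_mul_of_nonneg_left h3 hc0.le
      have e3 : c * (2 * Real.pi / β) ^ 2 = 2 := by rw [hc]; field_simp
      linarith
    rw [e1]; linarith
  · refine (mul_le_mul_right (lintegral_mono' Measure.restrict_le_self le_rfl) _).trans ?_
    rw [lintegral_gaussDensity ha, ← ENNReal.ofReal_mul (by positivity), wellMass_eq hγ hβ hε]
    refine ENNReal.ofReal_le_ofReal ?_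
    have hsq : √ε = Real.exp (-(L / 2)) := by
      rw [← exp_neg_log_one_div hε, Real.sqrt_eq_iff_mul_self_eq (Real.exp_pos _).le
        (Real.exp_pos _).le, ← Real.exp_add]
      congr 1; rw [hLdef]; ring
    have e : √(2 * Real.pi / c) / √(ε / (γ * β))
        = √(4 * Real.pi ^ 3 * γ / β) * Real.exp (L / 2) := by
      rw [Real.sqrt_div hε.le, hsq, Real.exp_neg, div_div_eq_mul_div, div_inv_eq_mul,
        ← Real.sqrt_mul (by positivity)]
      congr 2
      rw [hc]; field_simp; norm_num
    have h := hmass c hc0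
    rw [e] at h
    have hexp : Real.exp (-(p * L ^ 2)) * Real.exp (L / 2)
        ≤ Real.exp ((3 / 2) ^ 2 / (4 * p)) * ε := by
      have := mul_le_mul_of_nonneg_right (exp_quadratic_le hp0 (3 / 2) L) hε.le
      refine le_trans (le_of_eq ?_) this
      have e2 : Real.exp (-(p * L ^ 2)) * Real.exp (L / 2)
          = Real.exp (3 / 2 * L - p * L ^ 2) * Real.exp (-L) := by
        rw [← Real.exp_add, ← Real.exp_add]
        congr 1
        ring
      rw [e2, exp_neg_log_one_div hε]
    have hZ := gaussMass_pos (N := N) (wellPrecision_pos hγ hβ hε)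
    set Z := gaussMass N (wellPrecision γ β ε)
    set E := Real.exp (2 * Real.pi * γ / (ε * β))
    set S := √(4 * Real.pi ^ 3 * γ / β)
    calc E * (Real.exp 1 * Real.exp (-(p * L ^ 2))) * gaussMass N (precision c (-(1 / 2)) ε)
        ≤ E * (Real.exp 1 * Real.exp (-(p * L ^ 2))) * (Kz * (S * Real.exp (L / 2)) * Z) := by
          gcongr
      _ = E * Real.exp 1 * Kz * S * Z * (Real.exp (-(p * L ^ 2)) * Real.exp (L / 2)) := by ring
      _ ≤ E * Real.exp 1 * Kz * S * Z * (Real.exp ((3 / 2) ^ 2 / (4 * p)) * ε) := by gcongr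
      _ = _ := by ring

lemma abs_mean_le_of_mem_compl_targetSet {β ε : ℝ} {u : Coeff N} (hu : u ∈ (targetSet N β ε)ᶜ) :
    |mean u| ≤ 2 * Real.pi / β - √ε * Real.log (1 / ε) := by
  have h1 : ¬ mean u < -(2 * Real.pi / β) + √ε * Real.log (1 / ε) := fun h => hu (Or.inl h)
  have h2 : ¬ 2 * Real.pi / β - √ε * Real.log (1 / ε) < mean u := fun h => hu (Or.inr h)
  exact abs_le.2 ⟨by linarith, by linarith⟩

lemma disjoint_targetSet {β ε : ℝ} (hβ : 0 < β) (hδ : √ε * Real.log (1 / ε) ≤ Real.pi / (2 * β)) :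
    Disjoint {u : Coeff N | |mean u| < √ε * Real.log (1 / ε)} (targetSet N β ε) := by
  refine Set.disjoint_left.2 fun u hu hA => ?_
  obtain ⟨h1, h2⟩ := abs_lt.1 (show |mean u| < _ from hu)
  have e : 2 * Real.pi / β = 4 * (Real.pi / (2 * β)) := by field_simp; norm_num
  have hpos : 0 < Real.pi / (2 * β) := by positivity
  rcases hA with h | h
  · have : mean u < -(2 * Real.pi / β) + √ε * Real.log (1 / ε) := h
    linarith
  · have : 2 * Real.pi / β - √ε * Real.log (1 / ε) < mean u := h
    linarith

end SineGordon

end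

/-! ### Assembly of the lower and upper bounds. -/

open SineGordon in
theorem mainTheorem7
    (γ β : ℝ) (hγ : 0 < γ) (hβ : 0 < β)
    (κ : ℝ) (hκ : 0 < κ) (hκ' : κ < 1 / 2)
    (k : ℕ) (hk : 1 ≤ k)
    (θ : ℝ → ℝ) (hθ : SineGordon.IsDyadicCutoff θ) :
    ∃ cmin : ℝ, 0 < cmin ∧ ∀ c₀ : ℝ, cmin ≤ c₀ →
      ∃ C : ℝ, 0 < C ∧ ∃ ε₀ : ℝ, 0 < ε₀ ∧
        ∀ ε : ℝ, 0 < ε → ε < ε₀ → ∀ N : ℕ,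
          ∀ (Ω : Type*) [MeasurableSpace Ω] (P : Measure Ω) [IsProbabilityMeasure P]
            (W : SineGordon.Mode N → ℝ≥0 → Ω → ℝ)
            (X : SineGordon.Coeff N → ℝ≥0 → Ω → SineGordon.Coeff N),
            SineGordon.IsNoise P W →
            (∀ z, SineGordon.IsSolution γ β ε k P W z (X z)) →
            ENNReal.ofReal (SineGordon.wellMass N γ β ε * (1 - C * ε))
                ≤ ∫⁻ u in (SineGordon.targetSet N β ε)ᶜ,
                    SineGordon.equilibriumPotential P X
                        (SineGordon.initialSet N θ κ c₀ ε) (SineGordon.targetSet N β ε) u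
                      * ENNReal.ofReal (Real.exp (-SineGordon.energy γ β k u / ε)) ∧
              ∫⁻ u in (SineGordon.targetSet N β ε)ᶜ,
                    SineGordon.equilibriumPotential P X
                        (SineGordon.initialSet N θ κ c₀ ε) (SineGordon.targetSet N β ε) u
                      * ENNReal.ofReal (Real.exp (-SineGordon.energy γ β k u / ε))
                ≤ ENNReal.ofReal (SineGordon.wellMass N γ β ε
                    * (1 + C * ε * Real.log (1 / ε) ^ 4)) := by
  obtain ⟨cmin, hcmin, K, hK, htail⟩ := exists_besovHolderNorm_tail hκ hκ' hθ
  obtain ⟨G, hG, hsup⟩ := exists_abs_toFun_le hθ (show 0 < 1 / 2 - κ by linarith)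
  obtain ⟨Kz, hKz, hmass⟩ := exists_gaussMass_le hγ hβ
  refine ⟨cmin, hcmin, fun c₀ hc₀ => ?_⟩
  have hco := coercivity_pos hγ hβ
  have hc₀pos : 0 < c₀ := hcmin.trans_le hc₀
  set C₁ := 2 * Real.exp (1 / (4 * (Real.pi * γ * β))) + K with hC₁
  set C₂ := Real.pi * γ * β ^ 3 * (1 + G * √c₀) ^ 4 with hC₂
  set C₃ := K * Kz * √(γ * β / (2 * coercivity γ β)) with hC₃
  set C₄ := Real.exp 1 * Real.exp ((3 / 2) ^ 2 / (4 * (2 * Real.pi * coercivity γ β)))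
    * Kz * √(4 * Real.pi ^ 3 * γ / β) with hC₄
  have p1 : 0 < C₁ := by positivity
  have p2 : 0 < C₂ := by positivity
  have p3 : 0 < C₃ := by positivity
  have p4 : 0 < C₄ := by positivity
  -- `C₂` controls the quartic error on the initial set; the second summand forces `√ε log (1/ε) ≤
  -- π/(2β)`, which separates the initial set from the target.
  obtain ⟨ε₀, hε₀, hsmall⟩ := exists_small (C₂ + (2 * β / Real.pi) ^ 2) (by positivity)
  refine ⟨C₁ + 2 * C₂ + C₃ + C₄, by positivity, ε₀, hε₀, ?_⟩
  intro ε hε hεε₀ N Ω _ P _ W X hW hX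
  obtain ⟨hL, hsm⟩ := hsmall ε hε hεε₀
  have hM := wellMass_pos hγ hβ hε N
  have hL4 : 1 ≤ Real.log (1 / ε) ^ 4 := one_le_pow₀ hL
  have hL2 : Real.log (1 / ε) ^ 2 ≤ Real.log (1 / ε) ^ 4 := pow_le_pow_right₀ hL (by norm_num)
  have hpos4 : 0 < ε * Real.log (1 / ε) ^ 4 := by positivity
  have hsm2 : C₂ * (ε * Real.log (1 / ε) ^ 4) ≤ 1 := by
    have : 0 ≤ (2 * β / Real.pi) ^ 2 * (ε * Real.log (1 / ε) ^ 4) := by positivity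
    linarith
  have hδ : √ε * Real.log (1 / ε) ≤ Real.pi / (2 * β) := by
    have h1 : (2 * β / Real.pi * (√ε * Real.log (1 / ε))) ^ 2 ≤ 1 := by
      rw [mul_pow, mul_pow, Real.sq_sqrt hε.le]
      have h2 : 0 ≤ C₂ * (ε * Real.log (1 / ε) ^ 4) := by positivity
      have h3 : (2 * β / Real.pi) ^ 2 * (ε * Real.log (1 / ε) ^ 2)
          ≤ (2 * β / Real.pi) ^ 2 * (ε * Real.log (1 / ε) ^ 4) := by gcongr
      linarith
    have h2 := (sq_le_one_iff₀ (by positivity)).1 h1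
    rw [le_div_iff₀ (by positivity)]
    rw [div_mul_eq_mul_div, div_le_one Real.pi_pos] at h2
    linarith
  have hdisj := disjoint_targetSet (N := N) hβ hδ
  have hsubset : initialSet N θ κ c₀ ε ⊆ (targetSet N β ε)ᶜ := fun u hu hA =>
    Set.disjoint_left.1 hdisj hu.1 hA
  have hone : ∀ u ∈ initialSet N θ κ c₀ ε,
      equilibriumPotential P X (initialSet N θ κ c₀ ε) (targetSet N β ε) u = 1 := fun u hu =>
    equilibriumPotential_eq_one hW (hX u)
      (isOpen_lt continuous_mean.abs continuous_const) (show u ∈ {u : Coeff N | |mean u| < _}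
        from hu.1) hdisj hu
  have ht := fun a ha ha2 => htail c₀ hc₀ ε hε hL N a ha ha2
  have hz := fun c hc => hmass N c ε hc hε
  constructor
  · have hlow := le_lintegral_initialSet (N := N) (κ := κ) hγ hβ hε hL hK
      (ht _ (wellPrecision_pos hγ hβ hε)
        (le_precision (by nlinarith [mul_pos hγ hβ]) hε))
    have hmeas : Measurable fun u : Coeff N =>
        ENNReal.ofReal (gaussDensity (wellPrecision γ β ε) u) :=
      ENNReal.continuous_ofReal.measurable.comp (continuous_gaussDensity _).measurable
    calc ENNReal.ofReal (wellMass N γ β ε * (1 - (C₁ + 2 * C₂ + C₃ + C₄) * ε))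
        ≤ ENNReal.ofReal (Real.exp (2 * Real.pi * γ / (ε * β))) *
            ENNReal.ofReal (gaussMass N (wellPrecision γ β ε) * (1 - C₁ * ε)) := by
          have e : Real.exp (2 * Real.pi * γ / (ε * β))
              * (gaussMass N (wellPrecision γ β ε) * (1 - C₁ * ε))
              = wellMass N γ β ε * (1 - C₁ * ε) := by
            rw [wellMass_eq hγ hβ hε]; ring
          rw [← ENNReal.ofReal_mul (by positivity), e]
          have : C₁ ≤ C₁ + 2 * C₂ + C₃ + C₄ := by linarith
          gcongr
      _ ≤ ENNReal.ofReal (Real.exp (2 * Real.pi * γ / (ε * β))) *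
            ∫⁻ u in initialSet N θ κ c₀ ε,
              ENNReal.ofReal (gaussDensity (wellPrecision γ β ε) u) := by gcongr
      _ = ∫⁻ u in initialSet N θ κ c₀ ε, ENNReal.ofReal (Real.exp (2 * Real.pi * γ / (ε * β))) *
              ENNReal.ofReal (gaussDensity (wellPrecision γ β ε) u) :=
          (lintegral_const_mul _ hmeas).symm
      _ ≤ ∫⁻ u in initialSet N θ κ c₀ ε,
            equilibriumPotential P X (initialSet N θ κ c₀ ε) (targetSet N β ε) u
              * ENNReal.ofReal (Real.exp (-energy γ β k u / ε)) := by
          -- Measurability of the set replaces that of the equilibrium potential, which is known to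
          -- be `1` there.
          refine setLIntegral_mono' (measurableSet_initialSet θ κ c₀ ε) fun u hu => ?_
          rw [hone u hu, one_mul, ← ENNReal.ofReal_mul (by positivity)]
          refine ENNReal.ofReal_le_ofReal (gaussDensity_le_exp_neg_energy hγ hβ hε ?_)
          have h1 : |mean u| < √ε * Real.log (1 / ε) := hu.1
          have hk' : (1 : ℝ) ≤ k := by exact_mod_cast hk
          -- As `k ≥ 1`, the confining term vanishes on the initial set.
          have e : 2 * Real.pi * k / β = 4 * k * (Real.pi / (2 * β)) := by field_simp; norm_num
          have hpos : 0 < Real.pi / (2 * β) := by positivity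
          rw [e]
          nlinarith
      _ ≤ _ := lintegral_mono_set hsubset
  · have hcover : (targetSet N β ε)ᶜ ⊆ initialSet N θ κ c₀ ε ∪
        (({u : Coeff N | |mean u| < √ε * Real.log (1 / ε)} ∩
          {u | ENNReal.ofReal (√(c₀ * ε * Real.log (1 / ε)))
            ≤ besovHolderNorm θ (1 / 2 - κ) (perp u)}) ∪
        {u : Coeff N | √ε * Real.log (1 / ε) ≤ |mean u| ∧
          |mean u| ≤ 2 * Real.pi / β - √ε * Real.log (1 / ε)}) := by
      intro u hu
      by_cases h1 : √ε * Real.log (1 / ε) ≤ |mean u|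
      · exact Or.inr (Or.inr ⟨h1, abs_mean_le_of_mem_compl_targetSet hu⟩)
      by_cases h2 : ENNReal.ofReal (√(c₀ * ε * Real.log (1 / ε)))
          ≤ besovHolderNorm θ (1 / 2 - κ) (perp u)
      · exact Or.inr (Or.inl ⟨not_le.1 h1, h2⟩)
      exact Or.inl ⟨not_le.1 h1, not_le.1 h2⟩
    calc _ ≤ ∫⁻ u in (targetSet N β ε)ᶜ, ENNReal.ofReal (Real.exp (-energy γ β k u / ε)) :=
          lintegral_mono fun u => mul_le_of_le_one_left' prob_le_one
      _ ≤ _ := (lintegral_mono_set hcover).trans ((lintegral_union_le _ _ _).trans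
          (add_le_add_right (lintegral_union_le _ _ _) _))
      _ ≤ ENNReal.ofReal (wellMass N γ β ε * (1 + 2 * C₂ * (ε * Real.log (1 / ε) ^ 4)))
          + (ENNReal.ofReal (wellMass N γ β ε * (C₃ * ε))
            + ENNReal.ofReal (wellMass N γ β ε * (C₄ * ε))) :=
          add_le_add (lintegral_initialSet_le hγ hβ k hc₀pos.le hε hL hG (hsup N) hsm2)
            (add_le_add (lintegral_rough_le hγ hβ k hε hK hδ ht hz)
              (lintegral_between_wells_le hγ hβ k hε hL hKz hz))
      _ ≤ _ := by
          rw [← ENNReal.ofReal_add (by positivity) (by positivity),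
            ← ENNReal.ofReal_add (by positivity) (by positivity), ← mul_add, ← mul_add]
          refine ENNReal.ofReal_le_ofReal (mul_le_mul_of_nonneg_left ?_ hM.le)
          have h1 : ε ≤ ε * Real.log (1 / ε) ^ 4 := le_mul_of_one_le_right hε.le hL4
          have h3 := mul_le_mul_of_nonneg_left h1 p3.le
          have h4 := mul_le_mul_of_nonneg_left h1 p4.le
          have h5 : 0 ≤ C₁ * (ε * Real.log (1 / ε) ^ 4) := by positivity
          linarith
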